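/- Setting. Let $G,K$ be groups and let $U$ be a unitary representation of $G\times K$ on the local Hilbert space $\mathbb C^d$; on a periodic chain it acts by tensor powers. $G$ acts as a strong symmetry and $K$ as a weak one: a family of states $\rho_n$ on rings of $n$ sites is symmetric if $U_g^{\otimes n}\rho_n=e^{i\theta}\rho_n$, $\rho_n U_g^{\dagger\otimes n}=e^{-i\theta}\rho_n$ for every $g\in G$ (with a phase $\theta$ depending on $g$ and $n$), and $U_k^{\otimes n}\rho_nU_k^{\dagger\otimes n}=\rho_n$ for every $k\in K$. A local tensor of $\chi\times\chi$ matrices $\mathbb A^{ij}$ generates the family $\rho[\mathbb A]_n=\sum \mathrm{tr}(\mathbb A^{i_1j_1}\cdots\mathbb A^{i_nj_n})\,|i_1\dots i_n\rangle\langle j_1\dots j_n|$. It is a strong injective MPDO if all $\rho[\mathbb A]_n$ ($n\ge 1$) are positive semidefinite (density matrices up to normalization), $\mathbb A:\mathbb C^{\chi}\otimes\mathbb C^\chi\to\mathbb C^{d^2}$ is injective, and $\mathbb T=\sum_i\mathbb A^{ii}$ has a unique largest eigenvalue, which is real (multiplicity one, all other eigenvalues strictly smaller in modulus). Let $\mathbb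 G=(G_l\times G_r\times K)\rtimes\mathbb Z_2^{\mathbb H}$, where the generator $\mathbb H$ of $\mathbb Z_2^{\mathbb H}$ swaps $G_l=G$ and $G_r=G$ and commutes with $K$. On tensors, $(g,h,k)$ acts by $U_{(g,k)}$ on the ket index and $\overline{U_{(h,k)}}$ on the bra index, and $\mathbb H$ acts antilinearly by $\mathbb A^{ij}\mapsto\overline{\mathbb A^{ji}}$. A tensor $\mathbb A$ has class $[\omega]\in H^2(\mathbb G,\mathrm U_T(1))$ (antiunitary elements act on $\mathrm U(1)$ by complex conjugation) if there are phases $\theta_x$, invertible matrices $V_x$ and a 2-cocycle $\omega$ with $(x\cdot\mathbb A)^{ij}=\theta_xV_x^{-1}\mathbb A^{ij}V_x$ and $V_x\,{}^xV_y=\omega(x,y)V_{xy}$ for all $x,y\in\mathbb G$. A family of operators is in the SPT phase $[\omega]$ if, after grouping some number of neighbouring sites into blocks, it is, up to positive normalization factors, generated by a strong injective MPDO tensor of class $[\omega]$. A local channel circuit $\mathcal N$ consists of finitely many layers (their number independent of the length of the chain) on rings of $2n$ sites. Each layer is the tensor product of copies of one two-site quantum channel (gate), acting either on all pairs $(2x,2x+1)$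 or on all pairs $(2x+1,2x+2)$ of neighbouring sites. It is non-degenerate if every gate is injective as a linear map on operators. It is symmetric if every gate is: its Kraus operators satisfy $U_g^{\otimes2}K_aU_g^{\dagger\otimes2}=e^{i\theta_g}K_a$ with $\theta_g$ independent of $a$ for every $g\in G$, and the gate commutes with $X\mapsto U_k^{\otimes 2}XU_k^{\dagger\otimes 2}$ for every $k\in K$. Proposition. Let $\rho=\rho[\mathbb A]$ be a symmetric strong injective MPDO and $\mathcal N$ a symmetric non-degenerate local channel circuit. Then $\rho$ and $\mathcal N[\rho]$ (the latter on cells of two sites) are in the same SPT phase: each of the two is in an SPT phase (in particular $\mathcal N[\rho]$ is, after grouping sites, again a strong injective MPDO), each is in only one, and the two classes in $H^2(\mathbb G,\mathrm U_T(1))$ coincide. Corollary. Let $\rho$ be a family of states on cells of two sites that is in a non-trivial SPT phase $[\omega]\ne0$. Then $\rho$ is not of the form $\mathcal N\big[(|\varphi\rangle\langle\varphi|)^{\otimes 2n}\big]$ (for all $n\ge1$) with $\mathcal N$ a symmetric non-degenerate local channel circuit and $|\varphi\rangle\in\mathbb C^d$ a unit vector. -/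

import Mathlib

open scoped BigOperators Matrix ComplexConjugate ComplexOrder

noncomputable section

namespace MixedSPT

/-! ### Operators on periodic chains -/

/-- A family of operators, one on each periodic chain of `n` sites whose local Hilbert space has the
orthonormal basis `α`. An operator on `n` sites is a matrix indexed by configurations `Fin n → α`. -/
abbrev ChainState (α : Type*) := ∀ n : ℕ, Matrix (Fin n → α) (Fin n → α) ℂ

/-- Grouping `m` neighbouring sites into one: the chain of `n` blocks is the chain of `n * m` sites,
site `y` of block `x` being the site number `m * x + y`. -/
def group {α : Type*} (m : ℕ) (ρ : ChainState α) : ChainState (Fin m → α) := fun n =>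
  Matrix.of fun σ τ =>
    ρ (n * m) (fun s => σ (finProdFinEquiv.symm s).1 (finProdFinEquiv.symm s).2)
      (fun s => τ (finProdFinEquiv.symm s).1 (finProdFinEquiv.symm s).2)

/-- The tensor power `a ⊗ ⋯ ⊗ a` of an on-site operator, acting on `n` sites. -/
def tensorPow {α : Type*} (n : ℕ) (a : Matrix α α ℂ) : Matrix (Fin n → α) (Fin n → α) ℂ :=
  Matrix.of fun σ τ => ∏ x, a (σ x) (τ x)

/-- The pure product state with on-site vector `φ`. -/
def productState {α : Type*} (φ : α → ℂ) : ChainState α := fun _ =>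
  Matrix.of fun σ τ => (∏ x, φ (σ x)) * conj (∏ x, φ (τ x))

/-! ### Matrix product density operators -/

/-- A local tensor `A i j`, a `χ × χ` matrix for every ket index `i` and bra index `j`. -/
abbrev LocalTensor (α : Type*) (χ : ℕ) := α → α → Matrix (Fin χ) (Fin χ) ℂ

/-- The translation invariant family of operators generated by a local tensor:
the matrix element between `σ` and `τ` is `tr (A (σ 0) (τ 0) ⋯ A (σ (n-1)) (τ (n-1)))`. -/
def mpdo {α : Type*} {χ : ℕ} (A : LocalTensor α χ) : ChainState α := fun n =>
  Matrix.of fun σ τ => Matrix.trace (List.ofFn fun x : Fin n => A (σ x) (τ x)).prod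

/-- The transfer matrix `∑ i, A i i`. -/
def transfer {α : Type*} [Fintype α] {χ : ℕ} (A : LocalTensor α χ) :
    Matrix (Fin χ) (Fin χ) ℂ := ∑ i, A i i

/-- The tensor as a linear map from the virtual space `ℂ^χ ⊗ ℂ^χ` to the physical space. -/
def tensorMap {α : Type*} {χ : ℕ} (A : LocalTensor α χ) (X : Matrix (Fin χ) (Fin χ) ℂ) :
    α × α → ℂ := fun p => ∑ a, ∑ b, A p.1 p.2 a b * X a b

/-- A strong injective MPDO. The operators generated by the tensor are positive semidefinite (density
operators up to normalization), the tensor is an injective map from the virtual to the physical space,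
and the transfer matrix has a unique largest eigenvalue, which is real: it has multiplicity one, and
all other eigenvalues are strictly smaller in modulus. -/
structure IsStrongInjective {α : Type*} [Fintype α] {χ : ℕ} (A : LocalTensor α χ) :
    Prop where
  posSemidef : ∀ n, 0 < n → (mpdo A n).PosSemidef
  injective : Function.Injective (tensorMap A)
  transfer_gap : ∃ r : ℝ, (transfer A).charpoly.rootMultiplicity (r : ℂ) = 1 ∧
    ∀ z : ℂ, (transfer A).charpoly.IsRoot z → z ≠ (r : ℂ) → ‖z‖ < |r|

/-- `ρ` is, up to normalization, the family generated by the tensor `A`. -/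
def Represents {α : Type*} {χ : ℕ} (A : LocalTensor α χ) (ρ : ChainState α) : Prop :=
  ∀ n, 0 < n → ∃ s : ℝ, 0 < s ∧ ρ n = (s : ℂ) • mpdo A n

/-! ### The symmetry of the doubled state

The symmetry of the density matrix is `G × K` with `G` strong and `K` weak, acting on a site by the
matrices `u (g, k)`. -/

/-- The automorphism of `G_l × G_r × K` that swaps the two copies of `G`. -/
def swapAut (G K : Type*) [Group G] [Group K] : MulAut (G × G × K) where
  toFun x := (x.2.1, x.1, x.2.2)
  invFun x := (x.2.1, x.1, x.2.2)
  left_inv _ := rfl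
  right_inv _ := rfl
  map_mul' _ _ := rfl

/-- The action of `ℤ₂` on `G_l × G_r × K` by swapping. -/
def swapHom (G K : Type*) [Group G] [Group K] :
    Multiplicative (ZMod 2) →* MulAut (G × G × K) where
  toFun s := if s = 1 then 1 else swapAut G K
  map_one' := by simp
  map_mul' s t := by
    have h : swapAut G K * swapAut G K = 1 := rfl
    have hs : s = 1 ∨ s = Multiplicative.ofAdd 1 := by revert s; decide
    have ht : t = 1 ∨ t = Multiplicative.ofAdd 1 := by revert t; decide
    have h1 : (Multiplicative.ofAdd (1 : ZMod 2)) ≠ 1 := by decide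
    have h2 : (Multiplicative.ofAdd (1 : ZMod 2)) * Multiplicative.ofAdd 1 = 1 := by decide
    rcases hs with rfl | rfl <;> rcases ht with rfl | rfl <;> simp [h, h1, h2]

/-- The symmetry group `(G_l × G_r × K) ⋊ ℤ₂` of the doubled state. The generator of `ℤ₂` is the
Hermitian conjugation; an element acts antiunitarily when its `ℤ₂` component is not `1`. -/
abbrev DoubledSymmetry (G K : Type*) [Group G] [Group K] :=
  SemidirectProduct (G × G × K) (Multiplicative (ZMod 2)) (swapHom G K)

/-- The module `U_T(1)`: antiunitary elements act on `U(1)` by complex conjugation (inversion). -/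
instance {G K : Type*} [Group G] [Group K] : MulDistribMulAction (DoubledSymmetry G K) Circle where
  smul x a := if x.right = 1 then a else a⁻¹
  one_smul a := if_pos rfl
  mul_smul x y a := by
    change (if x.right * y.right = 1 then a else a⁻¹) =
      if x.right = 1 then (if y.right = 1 then a else a⁻¹) else (if y.right = 1 then a else a⁻¹)⁻¹
    generalize x.right = s
    generalize y.right = t
    have hs : s = 1 ∨ s = Multiplicative.ofAdd 1 := by revert s; decide
    have ht : t = 1 ∨ t = Multiplicative.ofAdd 1 := by revert t; decide
    have h1 : (Multiplicative.ofAdd (1 : ZMod 2)) ≠ 1 := by decide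
    have h2 : (Multiplicative.ofAdd (1 : ZMod 2)) * Multiplicative.ofAdd 1 = 1 := by decide
    rcases hs with rfl | rfl <;> rcases ht with rfl | rfl <;> simp [h1, h2]
  smul_mul x a b := by
    change (if x.right = 1 then a * b else (a * b)⁻¹) =
      (if x.right = 1 then a else a⁻¹) * (if x.right = 1 then b else b⁻¹)
    split_ifs
    · rfl
    · exact mul_inv a b
  smul_one x := by
    change (if x.right = 1 then (1 : Circle) else 1⁻¹) = 1
    simp

/-- The action of an element of the doubled symmetry on matrices over the virtual space:
entrywise complex conjugation if the element is antiunitary, and the identity otherwise. -/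
def conjBy {G K : Type*} [Group G] [Group K] {κ : Type*} (x : DoubledSymmetry G K)
    (M : Matrix κ κ ℂ) : Matrix κ κ ℂ :=
  if x.right = 1 then M else M.map conj

/-- The action of the doubled symmetry on the physical legs of a local tensor. The element `(g, h, k)`
of `G_l × G_r × K` acts by `u (g, k)` on the ket leg and by the conjugate of `u (h, k)` on the bra leg;
the Hermitian conjugation exchanges the two legs and conjugates the tensor. -/
def doubledAction {G K : Type*} [Group G] [Group K] {α : Type*} [Fintype α] {χ : ℕ}
    (u : G × K → Matrix α α ℂ) (x : DoubledSymmetry G K) (A : LocalTensor α χ) :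
    LocalTensor α χ := fun i j =>
  ∑ i', ∑ j', (u (x.left.1, x.left.2.2) i i' * conj (u (x.left.2.1, x.left.2.2) j j')) •
    conjBy x (if x.right = 1 then A i' j' else A j' i')

/-- The second cohomology group of the doubled symmetry with coefficients in `U_T(1)`
(written additively). -/
abbrev SPTClass (G K : Type) [Group G] [Group K] :=
  groupCohomology.H2 (Rep.ofMulDistribMulAction (DoubledSymmetry G K) Circle)

/-- The local tensor `A` carries the class `c`: the symmetry acts on the virtual space by a projective
representation `V` with a 2-cocycle `ω` of class `c`. -/
def HasTensorClass {G K : Type} [Group G] [Group K] {α : Type*} [Fintype α] {χ : ℕ}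
    (u : G × K → Matrix α α ℂ) (A : LocalTensor α χ) (c : SPTClass G K) : Prop :=
  ∃ (V : DoubledSymmetry G K → GL (Fin χ) ℂ) (θ : DoubledSymmetry G K → Circle)
    (ω : DoubledSymmetry G K × DoubledSymmetry G K → Circle),
    (∀ x i j, doubledAction u x A i j =
      (θ x : ℂ) • (((V x)⁻¹ : GL (Fin χ) ℂ).val * A i j * (V x).val)) ∧
    (∀ x y, (V x).val * conjBy x (V y).val = (ω (x, y) : ℂ) • (V (x * y)).val) ∧
    ∃ h : groupCohomology.IsMulCocycle₂ ω,
      groupCohomology.H2π (Rep.ofMulDistribMulAction (DoubledSymmetry G K) Circle)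
        (groupCohomology.cocyclesOfIsMulCocycle₂ h) = c

/-- The family `ρ` is, after grouping some number `m` of sites, a strong injective MPDO whose doubled
state is in the SPT phase `c`. -/
def HasSPTClass {G K : Type} [Group G] [Group K] {α : Type*} [Fintype α]
    (u : G × K → Matrix α α ℂ) (ρ : ChainState α) (c : SPTClass G K) : Prop :=
  ∃ m : ℕ, 0 < m ∧ ∃ (χ : ℕ) (B : LocalTensor (Fin m → α) χ),
    IsStrongInjective B ∧ Represents B (group m ρ) ∧
      HasTensorClass (fun p => tensorPow m (u p)) B c

/-- Both families are strong injective MPDOs (after grouping sites), each of them has exactly one SPT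
class, and the two classes agree. -/
def SameSPTPhase {G K : Type} [Group G] [Group K] {α β : Type*} [Fintype α] [Fintype β]
    (u : G × K → Matrix α α ℂ) (ρ : ChainState α)
    (v : G × K → Matrix β β ℂ) (ρ' : ChainState β) : Prop :=
  ∃ c : SPTClass G K, (∀ c', HasSPTClass u ρ c' ↔ c' = c) ∧ (∀ c', HasSPTClass v ρ' c' ↔ c' = c)

/-- `ρ` has the strong symmetry `G` (up to phases) and the weak symmetry `K`. -/
def IsSymmetricState {G K : Type} [Group G] [Group K] {α : Type*} [Fintype α]
    (u : G × K → Matrix α α ℂ) (ρ : ChainState α) : Prop :=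
  ∀ n, 0 < n →
    (∀ g : G, ∃ z : Circle, tensorPow n (u (g, 1)) * ρ n = (z : ℂ) • ρ n ∧
      ρ n * (tensorPow n (u (g, 1)))ᴴ = conj (z : ℂ) • ρ n) ∧
    (∀ k : K, tensorPow n (u (1, k)) * ρ n * (tensorPow n (u (1, k)))ᴴ = ρ n)

/-! ### Local channels -/

/-- A quantum channel in Kraus form. -/
structure Channel (β : Type*) [Fintype β] [DecidableEq β] where
  num : ℕ
  kraus : Fin num → Matrix β β ℂ
  trace_preserving : ∑ a, (kraus a)ᴴ * kraus a = 1

/-- The action `X ↦ ∑ a, K_a X K_aᴴ` of a channel. -/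
def Channel.map {β : Type*} [Fintype β] [DecidableEq β] (N : Channel β) (X : Matrix β β ℂ) :
    Matrix β β ℂ := ∑ a, N.kraus a * X * (N.kraus a)ᴴ

/-- A channel is non-degenerate if it is injective on all operators. -/
def Channel.IsNondegenerate {β : Type*} [Fintype β] [DecidableEq β] (N : Channel β) : Prop :=
  Function.Injective N.map

/-- `G` is a strong symmetry of the channel, and `K` is a weak symmetry of it. -/
def Channel.IsSymmetric {G K : Type} [Group G] [Group K] {β : Type*} [Fintype β] [DecidableEq β]
    (v : G × K → Matrix β β ℂ) (N : Channel β) : Prop :=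
  (∀ g : G, ∃ z : Circle, ∀ a, v (g, 1) * N.kraus a * (v (g, 1))ᴴ = (z : ℂ) • N.kraus a) ∧
  (∀ (k : K) (X : Matrix β β ℂ),
    v (1, k) * N.map ((v (1, k))ᴴ * X * v (1, k)) * (v (1, k))ᴴ = N.map X)

/-- On a ring of `n` cells of two sites each, the `x`-th pair of sites acted on by a gate:
for `odd = false` the two sites of cell `x`, for `odd = true` the second site of cell `x` and the
first site of the next cell. -/
def pairOf {α : Type*} (odd : Bool) {n : ℕ} (σ : Fin n → Fin 2 → α) (x : Fin n) : Fin 2 → α :=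
  if odd then ![σ x 1, σ (finRotate n x) 0] else σ x

/-- One layer of a brickwork circuit: the tensor product of copies of a two-site channel, acting on
the disjoint pairs of neighbouring sites of the given parity. -/
def applyLayer {α : Type*} [Fintype α] [DecidableEq α] (odd : Bool) (N : Channel (Fin 2 → α))
    (ρ : ChainState (Fin 2 → α)) : ChainState (Fin 2 → α) := fun n =>
  ∑ a : Fin n → Fin N.num,
    let K : Matrix (Fin n → Fin 2 → α) (Fin n → Fin 2 → α) ℂ :=
      Matrix.of fun σ τ => ∏ x, N.kraus (a x) (pairOf odd σ x) (pairOf odd τ x)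
    K * ρ n * Kᴴ

/-- A local channel circuit: a finite list of layers, the head of the list acting first. The depth is
the length of the list; it does not depend on the length of the chain. -/
abbrev ChannelCircuit (α : Type*) [Fintype α] [DecidableEq α] := List (Bool × Channel (Fin 2 → α))

/-- The action of a circuit on a family of operators. -/
def ChannelCircuit.apply {α : Type*} [Fintype α] [DecidableEq α] (C : ChannelCircuit α)
    (ρ : ChainState (Fin 2 → α)) : ChainState (Fin 2 → α) :=
  C.foldl (fun ρ' l => applyLayer l.1 l.2 ρ') ρ

end MixedSPT

end

/-!
Both claims follow from the fact that the class of a family of operators depends on the operators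
alone and is preserved by every layer of the circuit. A family is `GeneratedInClass` when it is
generated by a strong injective tensor of the given class without grouping sites; `HasSPTClass`
asks for this after grouping.

*The class is well defined.* Injectivity of a tensor says that its matrices span the matrix
algebra (`injective_tensorMap_iff`). If two spanning families of matrices, indexed by the same
set, have proportional traces of products of two and of three members, then the linear map sending
one to the other exists and is, up to a scalar, an isomorphism of algebras, hence inner
(`SpansMatrices.exists_conj`). So two injective tensors generating the same operators are
conjugate up to a scalar, and the projective representations on their virtual spaces then have
cohomologous factor systems (`GeneratedInClass.unique`). Applied to a tensor and to its transform
under the doubled symmetry, the same fact gives the projective representation of a symmetric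
tensor (`exists_hasTensorClass`). Blocks of a tensor carry the class of the tensor, which compares
different ways of grouping sites (`GeneratedInClass.group`, `HasSPTClass.unique`).

*Layers on the cells.* A symmetric non-degenerate channel acts on the physical legs only. It keeps
the transfer matrix because it preserves the trace, it keeps injectivity because it is invertible,
and it commutes with the symmetry up to phases, so that the virtual symmetry stays as it is
(`GeneratedInClass.superLayer`).

*Layers between the cells.* Such a layer is a layer on the cells preceded and followed by a shift
by one site. Write the tensor of a block as a product `X Y` cut next to a boundary site, along a
virtual space of minimal dimension. The tensor of the shifted blocks is `Y X`; its transfer matrix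
has the same nonzero spectrum, and `Y (X Y) X` is injective because `X Y` is. The symmetry acts on
the new virtual space with the same factor system, as `X` intertwines the old and the new action
(`exists_virtual_symmetry`, `GeneratedInClass.regroup`, `HasSPTClass.shift`).

*Product states.* If the output of the circuit is in some phase, it is symmetric on some ring.
Since the layers are injective and commute with the symmetry, so is the product state, and its
on-site vector is an eigenvector of every symmetry operator (`IsConjInvariant.of_apply`,
`exists_eigenvalue_of_isConjInvariant`). It is then generated by a tensor of bond dimension one,
of trivial class, and the output has trivial class.
-/

noncomputable section

namespace MixedSPT

/-! ### Spanning families of matrices -/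

/-- The matrices `a p` span the full matrix algebra. -/
def SpansMatrices {P : Type*} {χ : ℕ} (a : P → Matrix (Fin χ) (Fin χ) ℂ) : Prop :=
  Submodule.span ℂ (Set.range a) = ⊤

/-- A family spans the matrix algebra iff it is separating for the trace pairing. -/
theorem spansMatrices_iff {P : Type*} {χ : ℕ} {a : P → Matrix (Fin χ) (Fin χ) ℂ} :
    SpansMatrices a ↔ ∀ Z, (∀ p, (Z * a p).trace = 0) → Z = 0 := by
  constructor
  · intro h Z hZ
    have key : ∀ M, (Z * M).trace = 0 := by
      intro M
      have hM : M ∈ Submodule.span ℂ (Set.range a) := by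
        rw [show Submodule.span ℂ (Set.range a) = ⊤ from h]; trivial
      induction hM using Submodule.span_induction with
      | mem x hx => obtain ⟨p, rfl⟩ := hx; exact hZ p
      | zero => simp
      | add x y _ _ hx hy => simp [mul_add, hx, hy]
      | smul c x _ hx => simp [hx]
    exact Matrix.ext_iff_trace_mul_right.2 fun M => by simpa using key M
  · intro h
    by_contra hne
    obtain ⟨f, hf0, hf⟩ := Submodule.exists_le_ker_of_lt_top _ (lt_top_iff_ne_top.2 hne)
    -- the functional `f` is the trace pairing with the matrix of its values on matrix units
    let Z : Matrix (Fin χ) (Fin χ) ℂ := Matrix.of fun i j => f (Matrix.single j i 1)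
    have hfZ : ∀ M, f M = (Z * M).trace := by
      intro M
      conv_lhs => rw [Matrix.matrix_eq_sum_single M]
      simp only [map_sum, Matrix.trace, Matrix.diag, Matrix.mul_apply, Z, Matrix.of_apply]
      rw [Finset.sum_comm]
      refine Finset.sum_congr rfl fun i _ => Finset.sum_congr rfl fun j _ => ?_
      have : Matrix.single j i (M j i) = M j i • Matrix.single j i (1 : ℂ) := by simp
      rw [this, map_smul, smul_eq_mul, mul_comm]
    have hZ : Z = 0 := h Z fun p => by
      rw [← hfZ]
      exact hf (Submodule.subset_span ⟨p, rfl⟩)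
    exact hf0 (LinearMap.ext fun M => by simp [hfZ, hZ])

theorem SpansMatrices.eq_zero {P : Type*} {χ : ℕ} {a : P → Matrix (Fin χ) (Fin χ) ℂ}
    (h : SpansMatrices a) {Z : Matrix (Fin χ) (Fin χ) ℂ} (hZ : ∀ p, (Z * a p).trace = 0) : Z = 0 :=
  spansMatrices_iff.1 h Z hZ

/-- Linear identities can be checked on a spanning family. -/
theorem SpansMatrices.linearMap_ext {P : Type*} {χ : ℕ} {a : P → Matrix (Fin χ) (Fin χ) ℂ}
    (h : SpansMatrices a) {N : Type*} [AddCommMonoid N] [Module ℂ N]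
    {f g : Matrix (Fin χ) (Fin χ) ℂ →ₗ[ℂ] N} (hfg : ∀ p, f (a p) = g (a p)) : f = g :=
  LinearMap.ext_on_range h hfg

/-- Spanning families with proportional traces of products of two and of three members are related by a
linear isomorphism that is multiplicative up to a scalar. Products of two members determine all linear
relations in a family, and products of three members determine the multiplication. -/
theorem SpansMatrices.exists_linearEquiv {P : Type*} {χ χ' : ℕ}
    {a : P → Matrix (Fin χ) (Fin χ) ℂ} {b : P → Matrix (Fin χ') (Fin χ') ℂ}
    (ha : SpansMatrices a) (hb : SpansMatrices b) {s₂ s₃ : ℂ} (hs₂ : s₂ ≠ 0)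
    (h₂ : ∀ p q, (a p * a q).trace = s₂ * (b p * b q).trace)
    (h₃ : ∀ p q r, (a p * a q * a r).trace = s₃ * (b p * b q * b r).trace) :
    ∃ φ : Matrix (Fin χ) (Fin χ) ℂ ≃ₗ[ℂ] Matrix (Fin χ') (Fin χ') ℂ,
      (∀ p, φ (a p) = b p) ∧ ∀ X Y, s₃ • (φ X * φ Y) = s₂ • φ (X * Y) := by
  set la := Finsupp.linearCombination ℂ a with hla
  set lb := Finsupp.linearCombination ℂ b with hlb
  have hsurj : Function.Surjective la := by
    rw [← LinearMap.range_eq_top, Finsupp.range_linearCombination]; exact ha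
  obtain ⟨g, hg⟩ := la.exists_rightInverse_of_surjective (LinearMap.range_eq_top.2 hsurj)
  have hg' : ∀ X, la (g X) = X := fun X => LinearMap.congr_fun hg X
  have k₂ : ∀ f f', (la f * la f').trace = s₂ * (lb f * lb f').trace := by
    intro f f'
    simp only [hla, hlb, Finsupp.linearCombination_apply, Finsupp.sum, Finset.sum_mul,
      Finset.mul_sum, Matrix.trace_sum, Matrix.smul_mul, Matrix.mul_smul, Matrix.trace_smul, h₂,
      smul_eq_mul]
    exact Finset.sum_congr rfl fun _ _ => Finset.sum_congr rfl fun _ _ => by ring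
  have k₃ : ∀ f f' f'', (la f * la f' * la f'').trace = s₃ * (lb f * lb f' * lb f'').trace := by
    intro f f' f''
    simp only [hla, hlb, Finsupp.linearCombination_apply, Finsupp.sum, Finset.sum_mul,
      Finset.mul_sum, Matrix.trace_sum, Matrix.smul_mul, Matrix.mul_smul, Matrix.trace_smul, h₃,
      smul_eq_mul]
    exact Finset.sum_congr rfl fun _ _ => Finset.sum_congr rfl fun _ _ =>
      Finset.sum_congr rfl fun _ _ => by ring
  set φ := lb ∘ₗ g with hφ
  have e₂ : ∀ X q, (X * a q).trace = s₂ * (φ X * b q).trace := by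
    intro X q
    have := k₂ (g X) (Finsupp.single q 1)
    rw [hg'] at this
    simpa [hla, hlb, hφ] using this
  have hφa : ∀ p, φ (a p) = b p := by
    intro p
    rw [← sub_eq_zero]
    refine hb.eq_zero fun q => ?_
    have := e₂ (a p) q
    rw [h₂] at this
    rw [Matrix.sub_mul, Matrix.trace_sub, mul_left_cancel₀ hs₂ this, sub_self]
  have inj : Function.Injective φ := by
    rw [injective_iff_map_eq_zero]
    intro X hX
    exact ha.eq_zero fun q => by rw [e₂, hX]; simp
  have surj : Function.Surjective φ := by
    rw [← LinearMap.range_eq_top, eq_top_iff, ← show Submodule.span ℂ (Set.range b) = ⊤ from hb,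
      Submodule.span_le]
    rintro _ ⟨p, rfl⟩
    exact ⟨a p, hφa p⟩
  refine ⟨LinearEquiv.ofBijective φ ⟨inj, surj⟩, hφa, fun X Y => ?_⟩
  change s₃ • (φ X * φ Y) = s₂ • φ (X * Y)
  rw [← sub_eq_zero]
  refine hb.eq_zero fun q => ?_
  have h := k₃ (g X) (g Y) (Finsupp.single q 1)
  rw [hg', hg'] at h
  have h' : (X * Y * a q).trace = s₃ * (φ X * φ Y * b q).trace := by simpa [hla, hlb, hφ] using h
  rw [e₂] at h'
  simp [Matrix.sub_mul, h']

/-- Algebra automorphisms of a full matrix algebra are inner. -/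
theorem exists_conj_of_algEquiv {χ : ℕ}
    (f : Matrix (Fin χ) (Fin χ) ℂ ≃ₐ[ℂ] Matrix (Fin χ) (Fin χ) ℂ) :
    ∃ X : GL (Fin χ) ℂ, ∀ M, f M = (X⁻¹).val * M * X.val := by
  obtain ⟨T, hT⟩ := AlgEquiv.eq_linearEquivConjAlgEquiv
    ((Matrix.toLinAlgEquiv' (R := ℂ) (n := Fin χ)).symm.trans
      (f.trans (Matrix.toLinAlgEquiv' (R := ℂ) (n := Fin χ))))
  have h1 : LinearMap.toMatrix' T.symm.toLinearMap * LinearMap.toMatrix' T.toLinearMap = 1 := by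
    rw [← LinearMap.toMatrix'_comp]; simp
  have h2 : LinearMap.toMatrix' T.toLinearMap * LinearMap.toMatrix' T.symm.toLinearMap = 1 := by
    rw [← LinearMap.toMatrix'_comp]; simp
  refine ⟨⟨LinearMap.toMatrix' T.symm.toLinearMap, LinearMap.toMatrix' T.toLinearMap, h1, h2⟩,
    fun M => ?_⟩
  have h := DFunLike.congr_fun hT (Matrix.toLin' M)
  rw [LinearEquiv.conjAlgEquiv_apply] at h
  have h' : Matrix.toLin' (f M) = T.toLinearMap ∘ₗ Matrix.toLin' M ∘ₗ T.symm.toLinearMap := by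
    refine Eq.trans ?_ h
    change _ = Matrix.toLin' (f (LinearMap.toMatrix' (Matrix.toLin' M)))
    rw [LinearMap.toMatrix'_toLin']
  have h'' := congrArg LinearMap.toMatrix' h'
  rw [LinearMap.toMatrix'_toLin', LinearMap.toMatrix'_comp, LinearMap.toMatrix'_comp,
    LinearMap.toMatrix'_toLin'] at h''
  rw [h'', ← mul_assoc]
  rfl

theorem SpansMatrices.dim_eq {P : Type*} {χ χ' : ℕ}
    {a : P → Matrix (Fin χ) (Fin χ) ℂ} {b : P → Matrix (Fin χ') (Fin χ') ℂ}
    (ha : SpansMatrices a) (hb : SpansMatrices b) {s₂ s₃ : ℂ} (hs₂ : s₂ ≠ 0)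
    (h₂ : ∀ p q, (a p * a q).trace = s₂ * (b p * b q).trace)
    (h₃ : ∀ p q r, (a p * a q * a r).trace = s₃ * (b p * b q * b r).trace) : χ = χ' := by
  obtain ⟨φ, -, -⟩ := ha.exists_linearEquiv hb hs₂ h₂ h₃
  have := φ.finrank_eq
  simp only [Module.finrank_matrix, Fintype.card_fin, Module.finrank_self, mul_one] at this
  exact Nat.mul_self_inj.1 this

/-- Two spanning families of matrices with proportional traces of products of two and of three members
are related by a conjugation and a scalar. -/
theorem SpansMatrices.exists_conj {P : Type*} {χ : ℕ}
    {a b : P → Matrix (Fin χ) (Fin χ) ℂ}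
    (ha : SpansMatrices a) (hb : SpansMatrices b) {s₂ s₃ : ℂ} (hs₂ : s₂ ≠ 0) (hs₃ : s₃ ≠ 0)
    (h₂ : ∀ p q, (a p * a q).trace = s₂ * (b p * b q).trace)
    (h₃ : ∀ p q r, (a p * a q * a r).trace = s₃ * (b p * b q * b r).trace) :
    ∃ (X : GL (Fin χ) ℂ) (t : ℂ), t ≠ 0 ∧ ∀ p, b p = t • ((X⁻¹).val * a p * X.val) := by
  obtain ⟨φ, hφ, hmul⟩ := ha.exists_linearEquiv hb hs₂ h₂ h₃
  have hc : s₃ / s₂ ≠ 0 := div_ne_zero hs₃ hs₂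
  let ψ := φ.trans (LinearEquiv.smulOfNeZero ℂ (Matrix (Fin χ) (Fin χ) ℂ) (s₃ / s₂) hc)
  have hψ : ∀ X, ψ X = (s₃ / s₂) • φ X := fun X => rfl
  have hψmul : ∀ X Y, ψ (X * Y) = ψ X * ψ Y := by
    intro X Y
    have h : φ (X * Y) = (s₃ / s₂) • (φ X * φ Y) := by
      rw [div_eq_inv_mul, mul_smul, hmul, smul_smul, inv_mul_cancel₀ hs₂, one_smul]
    rw [hψ, hψ, hψ, h, Matrix.smul_mul, Matrix.mul_smul]
  have hψone : ψ 1 = 1 := by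
    obtain ⟨Y, hY⟩ := ψ.surjective 1
    have := hψmul 1 Y
    rw [one_mul, hY, mul_one] at this
    exact this.symm
  obtain ⟨X, hX⟩ := exists_conj_of_algEquiv (AlgEquiv.ofLinearEquiv ψ hψone hψmul)
  refine ⟨X, (s₃ / s₂)⁻¹, inv_ne_zero hc, fun p => ?_⟩
  rw [← hX, AlgEquiv.ofLinearEquiv_apply, hψ, smul_smul, inv_mul_cancel₀ hc, one_smul, hφ]

/-- A matrix whose conjugation rescales a spanning family is a scalar. -/
theorem SpansMatrices.exists_scalar {P : Type*} {χ : ℕ} (hχ : 0 < χ)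
    {a : P → Matrix (Fin χ) (Fin χ) ℂ} (ha : SpansMatrices a) {Z : Matrix (Fin χ) (Fin χ) ℂ}
    (hZ : IsUnit Z) {s : ℂ} (h : ∀ p, a p * Z = s • (Z * a p)) :
    ∃ c : ℂ, c ≠ 0 ∧ Z = c • 1 := by
  have key : LinearMap.mulRight ℂ Z = s • LinearMap.mulLeft ℂ Z :=
    ha.linearMap_ext fun p => by simpa using h p
  have key' : ∀ M, M * Z = s • (Z * M) := fun M => by simpa using LinearMap.congr_fun key M
  have : Nonempty (Fin χ) := ⟨⟨0, hχ⟩⟩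
  have hZ0 : Z ≠ 0 := hZ.ne_zero
  have hs : s = 1 := by
    have h1 := key' 1
    rw [one_mul, mul_one] at h1
    have : (1 - s) • Z = 0 := by rw [sub_smul, one_smul, ← h1, sub_self]
    rcases smul_eq_zero.1 this with h | h
    · linear_combination -h
    · exact absurd h hZ0
  have hcomm : Z ∈ Set.range (Matrix.scalar (Fin χ) : ℂ → _) := by
    refine Matrix.mem_range_scalar_of_commute_single fun i j _ => ?_
    have := key' (Matrix.single i j 1)
    rw [hs, one_smul] at this
    exact this
  obtain ⟨c, hc⟩ := hcomm
  have hc' : Z = c • 1 := by rw [← hc]; simp [Matrix.smul_one_eq_diagonal]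
  refine ⟨c, ?_, hc'⟩
  rintro rfl
  exact hZ0 (by simpa using hc')

/-! ### Dominant eigenvalues -/

/-- `r` is an eigenvalue of algebraic multiplicity one, and every other eigenvalue is strictly
smaller in modulus. -/
def IsDominant {χ : ℕ} (T : Matrix (Fin χ) (Fin χ) ℂ) (r : ℝ) : Prop :=
  T.charpoly.rootMultiplicity (r : ℂ) = 1 ∧
    ∀ z : ℂ, T.charpoly.IsRoot z → z ≠ (r : ℂ) → ‖z‖ < |r|

theorem IsDominant.isRoot {χ : ℕ} {T : Matrix (Fin χ) (Fin χ) ℂ} {r : ℝ} (h : IsDominant T r) :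
    T.charpoly.IsRoot (r : ℂ) := by
  rw [← Polynomial.rootMultiplicity_pos T.charpoly_monic.ne_zero, h.1]
  exact one_pos

/-- If the dominant eigenvalue vanishes, so do all eigenvalues and hence the trace. -/
theorem IsDominant.trace_eq_zero {χ : ℕ} {T : Matrix (Fin χ) (Fin χ) ℂ} (h : IsDominant T 0) :
    T.trace = 0 := by
  rw [Matrix.trace_eq_sum_roots_charpoly]
  refine Multiset.sum_eq_zero fun z hz => ?_
  by_contra hz0
  have := h.2 z ((Polynomial.mem_roots T.charpoly_monic.ne_zero).1 hz) (by simpa using hz0)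
  rw [abs_zero] at this
  exact absurd (norm_nonneg z) (not_le.2 this)

theorem IsDominant.dim_pos {χ : ℕ} {T : Matrix (Fin χ) (Fin χ) ℂ} {r : ℝ} (h : IsDominant T r) :
    0 < χ := by
  rcases Nat.eq_zero_or_pos χ with rfl | h0
  · have := h.isRoot
    simp [Matrix.charpoly, Polynomial.IsRoot] at this
  · exact h0

/-- The nonzero spectrum of a product of two matrices does not depend on their order. -/
theorem IsDominant.mul_comm {χ D : ℕ} {A : Matrix (Fin χ) (Fin D) ℂ}
    {B : Matrix (Fin D) (Fin χ) ℂ} {r : ℝ} (hr : r ≠ 0) (h : IsDominant (A * B) r) :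
    IsDominant (B * A) r := by
  have key := Matrix.charpoly_mul_comm' A B
  have hX : ∀ k : ℕ, ((Polynomial.X : Polynomial ℂ) ^ k).rootMultiplicity (r : ℂ) = 0 := by
    intro k
    apply Polynomial.rootMultiplicity_eq_zero
    simp [Polynomial.IsRoot, hr]
  have hne : ∀ k : ℕ, (Polynomial.X : Polynomial ℂ) ^ k ≠ 0 := fun k =>
    pow_ne_zero _ Polynomial.X_ne_zero
  constructor
  · have := congrArg (Polynomial.rootMultiplicity (r : ℂ)) key
    rw [Polynomial.rootMultiplicity_mul (mul_ne_zero (hne _) (A * B).charpoly_monic.ne_zero),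
      Polynomial.rootMultiplicity_mul (mul_ne_zero (hne _) (B * A).charpoly_monic.ne_zero),
      hX, hX, zero_add, zero_add, h.1] at this
    exact this.symm
  · intro z hz hzr
    by_cases hz0 : z = 0
    · subst hz0; simpa using hr
    · refine h.2 z ?_ hzr
      have := congrArg (Polynomial.eval z) key
      rw [Polynomial.eval_mul, Polynomial.eval_mul, show (B * A).charpoly.eval z = 0 from hz,
        mul_zero, Polynomial.eval_pow, Polynomial.eval_X] at this
      exact (mul_eq_zero.1 this).resolve_left (pow_ne_zero _ hz0)

theorem charpoly_rootMultiplicity_eq {χ : ℕ} (T : Matrix (Fin χ) (Fin χ) ℂ) (z : ℂ) :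
    T.charpoly.rootMultiplicity z =
      Module.finrank ℂ (Module.End.maxGenEigenspace (Matrix.toLin' T) z) := by
  rw [LinearMap.finrank_maxGenEigenspace_eq, ← Matrix.charpoly_toLin']

/-- A power of a matrix with a dominant eigenvalue has a dominant eigenvalue. With
`T ^ k - r ^ k = g(T) (T - r)`, no eigenvalue of `T` is a root of `g`, so that `g(T)` is invertible and
the generalized eigenspaces of `T` at `r` and of `T ^ k` at `r ^ k` agree. -/
theorem IsDominant.pow {χ : ℕ} {T : Matrix (Fin χ) (Fin χ) ℂ} {r : ℝ} (hr : r ≠ 0)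
    (h : IsDominant T r) {k : ℕ} (hk : 0 < k) : IsDominant (T ^ k) (r ^ k) := by
  have : Nonempty (Fin χ) := ⟨⟨0, h.dim_pos⟩⟩
  have hspec : ∀ z ∈ spectrum ℂ T, z ≠ (r : ℂ) → ‖z‖ < |r| := fun z hz =>
    h.2 z (Matrix.mem_spectrum_iff_isRoot_charpoly.1 hz)
  have hrc : (r : ℂ) ≠ 0 := by exact_mod_cast hr
  constructor
  · set f : Module.End ℂ (Fin χ → ℂ) := Matrix.toLin' T with hf
    have hfk : Matrix.toLin' (T ^ k) = f ^ k := by rw [Matrix.toLin'_pow]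
    have hspecf : ∀ z ∈ spectrum ℂ f, z ≠ (r : ℂ) → ‖z‖ < |r| := by
      intro z hz
      rw [hf, Matrix.spectrum_toLin'] at hz
      exact hspec z hz
    rw [charpoly_rootMultiplicity_eq, hfk, ← h.1, charpoly_rootMultiplicity_eq, ← hf]
    let p : Polynomial ℂ :=
      ∑ i ∈ Finset.range k, Polynomial.X ^ i * (Polynomial.C (r : ℂ)) ^ (k - 1 - i)
    have hp : p * (Polynomial.X - Polynomial.C (r : ℂ)) =
        Polynomial.X ^ k - Polynomial.C (r : ℂ) ^ k := geom_sum₂_mul _ _ k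
    have hroot : ∀ z ∈ spectrum ℂ f, p.eval z ≠ 0 := by
      intro z hz h0
      by_cases hzr : z = r
      · subst hzr
        have : p.eval (r : ℂ) = ∑ i ∈ Finset.range k, (r : ℂ) ^ (k - 1) := by
          simp only [p, Polynomial.eval_finsetSum, Polynomial.eval_mul, Polynomial.eval_pow,
            Polynomial.eval_X, Polynomial.eval_C]
          refine Finset.sum_congr rfl fun i hi => ?_
          rw [← pow_add]
          congr 1
          have := Finset.mem_range.1 hi
          omega
        rw [this, Finset.sum_const, Finset.card_range, nsmul_eq_mul] at h0
        exact mul_ne_zero (by exact_mod_cast hk.ne') (pow_ne_zero _ hrc) h0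
      · have h1 := congrArg (Polynomial.eval z) hp
        simp only [Polynomial.eval_mul, h0, zero_mul, Polynomial.eval_sub, Polynomial.eval_pow,
          Polynomial.eval_X, Polynomial.eval_C] at h1
        have h2 : ‖z‖ ^ k = |r| ^ k := by
          rw [← norm_pow, sub_eq_zero.1 h1.symm, norm_pow, Complex.norm_real, Real.norm_eq_abs]
        have := hspecf z hz hzr
        exact absurd h2 (pow_lt_pow_left₀ this (norm_nonneg _) hk.ne').ne
    have hunit : IsUnit (Polynomial.aeval f p) := by
      have h0 : (0 : ℂ) ∉ spectrum ℂ (Polynomial.aeval f p) := by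
        rw [spectrum.map_polynomial_aeval_of_nonempty _ _
          (spectrum.nonempty_of_isAlgClosed_of_finiteDimensional ℂ f)]
        rintro ⟨z, hz, hz0⟩
        exact hroot z hz hz0
      exact spectrum.zero_notMem_iff ℂ |>.1 h0
    have hfac : f ^ k - algebraMap ℂ _ ((r : ℂ) ^ k) =
        Polynomial.aeval f p * (f - algebraMap ℂ _ (r : ℂ)) := by
      have := congrArg (Polynomial.aeval f) hp
      simp only [map_mul, map_sub, map_pow, Polynomial.aeval_X, Polynomial.aeval_C] at this
      rw [this, map_pow]
    have hcomm : Commute (Polynomial.aeval f p) (f - algebraMap ℂ _ (r : ℂ)) := by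
      have : f - algebraMap ℂ _ (r : ℂ) =
          Polynomial.aeval f (Polynomial.X - Polynomial.C (r : ℂ)) := by simp
      rw [this]
      change _ * _ = _ * _
      rw [← map_mul, ← map_mul, _root_.mul_comm]
    have : (Module.End.maxGenEigenspace (f ^ k) ((r ^ k : ℝ) : ℂ)) =
        Module.End.maxGenEigenspace f (r : ℂ) := by
      ext v
      simp only [Module.End.mem_maxGenEigenspace]
      refine exists_congr fun n => ?_
      have e1 : (f ^ k - ((r ^ k : ℝ) : ℂ) • (1 : Module.End ℂ (Fin χ → ℂ))) =
          Polynomial.aeval f p * (f - (r : ℂ) • 1) := by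
        rw [Complex.ofReal_pow, ← Algebra.algebraMap_eq_smul_one, hfac,
          Algebra.algebraMap_eq_smul_one]
      have hcomm' : Commute (Polynomial.aeval f p)
          (f - (r : ℂ) • (1 : Module.End ℂ (Fin χ → ℂ))) := by
        rw [← Algebra.algebraMap_eq_smul_one]; exact hcomm
      rw [e1, hcomm'.mul_pow, Module.End.mul_apply]
      have hinj : Function.Injective ((Polynomial.aeval f p) ^ n : Module.End ℂ (Fin χ → ℂ)) :=
        ((Module.End.isUnit_iff _).1 (hunit.pow n)).1
      exact map_eq_zero_iff _ hinj
    rw [this]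
  · intro z hz hzr
    rw [← Matrix.mem_spectrum_iff_isRoot_charpoly, spectrum.map_pow_of_pos T hk] at hz
    obtain ⟨w, hw, rfl⟩ := hz
    have hwr : w ≠ r := by
      rintro rfl
      exact hzr (by simp)
    change ‖w ^ k‖ < _
    rw [norm_pow, abs_pow]
    exact pow_lt_pow_left₀ (hspec w hw hwr) (norm_nonneg _) hk.ne'

/-! ### Rank factorization -/

/-- Every matrix is the product of a left invertible and a right invertible matrix. -/
theorem exists_rank_factorization {m n : Type*} [Fintype m] [Fintype n] [DecidableEq m]
    [DecidableEq n] (M : Matrix m n ℂ) :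
    ∃ (D : ℕ) (X : Matrix m (Fin D) ℂ) (Y : Matrix (Fin D) n ℂ) (L : Matrix (Fin D) m ℂ)
      (R : Matrix n (Fin D) ℂ), M = X * Y ∧ L * X = 1 ∧ Y * R = 1 := by
  let f := Matrix.toLin' M
  let e : LinearMap.range f ≃ₗ[ℂ] (Fin (Module.finrank ℂ (LinearMap.range f)) → ℂ) :=
    (Module.finBasis ℂ (LinearMap.range f)).equivFun
  let x := (LinearMap.range f).subtype ∘ₗ e.symm.toLinearMap
  let y := e.toLinearMap ∘ₗ f.rangeRestrict
  have hx : LinearMap.ker x = ⊥ := by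
    rw [LinearMap.ker_eq_bot]
    exact Subtype.val_injective.comp e.symm.injective
  have hy : LinearMap.range y = ⊤ := by
    rw [LinearMap.range_eq_top]
    exact e.surjective.comp f.surjective_rangeRestrict
  obtain ⟨l, hl⟩ := x.exists_leftInverse_of_injective hx
  obtain ⟨s, hs⟩ := y.exists_rightInverse_of_surjective hy
  refine ⟨_, LinearMap.toMatrix' x, LinearMap.toMatrix' y, LinearMap.toMatrix' l,
    LinearMap.toMatrix' s, ?_, ?_, ?_⟩
  · rw [← LinearMap.toMatrix'_comp, ← LinearMap.toMatrix'_toLin' M]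
    congr 1
    ext v : 2
    simp [x, y, f]
  · rw [← LinearMap.toMatrix'_comp, hl, LinearMap.toMatrix'_id]
  · rw [← LinearMap.toMatrix'_comp, hs, LinearMap.toMatrix'_id]

/-! ### Blocks of local tensors and superoperators -/

/-- The tensor of a block of `n` sites: the matrix product of the tensors of its sites. -/
def blk {α : Type*} {χ : ℕ} (n : ℕ) (A : LocalTensor α χ) : LocalTensor (Fin n → α) χ :=
  fun σ τ => (List.ofFn fun x => A (σ x) (τ x)).prod

theorem mpdo_apply {α : Type*} {χ : ℕ} (A : LocalTensor α χ) (n : ℕ) (σ τ : Fin n → α) :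
    mpdo A n σ τ = (blk n A σ τ).trace := rfl

theorem list_prod_ofFn_sum {R ι : Type*} [Semiring R] [Fintype ι] :
    ∀ {n : ℕ} (f : Fin n → ι → R), (List.ofFn fun x => ∑ i, f x i).prod =
      ∑ σ : Fin n → ι, (List.ofFn fun x => f x (σ x)).prod
  | 0, f => by simp
  | n + 1, f => by
    rw [List.ofFn_succ, List.prod_cons, list_prod_ofFn_sum fun x => f x.succ, Finset.sum_mul,
      ← (Fin.consEquiv fun _ => ι).sum_comp, Fintype.sum_prod_type]
    refine Finset.sum_congr rfl fun i _ => ?_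
    rw [Finset.mul_sum]
    refine Finset.sum_congr rfl fun σ _ => ?_
    simp [List.ofFn_succ, Fin.consEquiv]

theorem list_prod_ofFn_smul {R : Type*} [Semiring R] [Algebra ℂ R] :
    ∀ {n : ℕ} (c : Fin n → ℂ) (M : Fin n → R), (List.ofFn fun x => c x • M x).prod =
      (∏ x, c x) • (List.ofFn M).prod
  | 0, c, M => by simp
  | n + 1, c, M => by
    rw [List.ofFn_succ, List.prod_cons, list_prod_ofFn_smul (fun x => c x.succ), List.ofFn_succ,
      List.prod_cons, Fin.prod_univ_succ, smul_mul_smul_comm]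

/-- A superoperator `S`, a matrix indexed by pairs of a ket and a bra index, acting on the physical
indices of a tensor with values in a vector space. -/
def lin {α E : Type*} [Fintype α] [AddCommMonoid E] [Module ℂ E] (S : Matrix (α × α) (α × α) ℂ)
    (A : α → α → E) : α → α → E :=
  fun i j => ∑ i', ∑ j', S (i, j) (i', j') • A i' j'

/-- The tensor power of a superoperator. -/
def spow {α : Type*} (n : ℕ) (S : Matrix (α × α) (α × α) ℂ) :
    Matrix ((Fin n → α) × (Fin n → α)) ((Fin n → α) × (Fin n → α)) ℂ :=
  Matrix.of fun p q => ∏ x, S (p.1 x, p.2 x) (q.1 x, q.2 x)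

/-- The superoperator `X ↦ a X bᴴ`. -/
def sandwich {α : Type*} (a b : Matrix α α ℂ) : Matrix (α × α) (α × α) ℂ :=
  Matrix.of fun p q => a p.1 q.1 * conj (b p.2 q.2)

/-- A superoperator acting on an operator. -/
def superMap {α : Type*} [Fintype α] (S : Matrix (α × α) (α × α) ℂ) (X : Matrix α α ℂ) :
    Matrix α α ℂ := Matrix.of (lin S fun i j => X i j)

/-- The tensor powers of a superoperator acting on a family of operators. -/
def superLayer {α : Type*} [Fintype α] (S : Matrix (α × α) (α × α) ℂ) (ρ : ChainState α) :
    ChainState α := fun n => superMap (spow n S) (ρ n)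

section lin

variable {α E F : Type*} [Fintype α] [AddCommMonoid E] [Module ℂ E] [AddCommMonoid F] [Module ℂ F]

theorem lin_apply (S : Matrix (α × α) (α × α) ℂ) (A : α → α → E) (i j : α) :
    lin S A i j = ∑ q : α × α, S (i, j) q • A q.1 q.2 := by
  rw [lin, Fintype.sum_prod_type]

theorem map_lin (f : E →ₗ[ℂ] F) (S : Matrix (α × α) (α × α) ℂ) (A : α → α → E) (i j : α) :
    f (lin S A i j) = lin S (fun i j => f (A i j)) i j := by
  simp [lin]

theorem lin_smul (c : ℂ) (S : Matrix (α × α) (α × α) ℂ) (A : α → α → E) (i j : α) :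
    lin S (fun i j => c • A i j) i j = c • lin S A i j := by
  simp only [lin, Finset.smul_sum, smul_comm c]

theorem smul_lin (c : ℂ) (S : Matrix (α × α) (α × α) ℂ) (A : α → α → E) (i j : α) :
    lin (c • S) A i j = c • lin S A i j := by
  simp only [lin, Finset.smul_sum, Matrix.smul_apply, smul_assoc]

theorem lin_lin (S S' : Matrix (α × α) (α × α) ℂ) (A : α → α → E) :
    lin S (lin S' A) = lin (S * S') A := by
  funext i j
  simp only [lin_apply, Matrix.mul_apply, Finset.smul_sum, Finset.sum_smul, mul_smul]
  rw [Finset.sum_comm]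

theorem lin_sum {κ : Type*} [Fintype κ] (S : κ → Matrix (α × α) (α × α) ℂ) (A : α → α → E)
    (i j : α) : lin (∑ a, S a) A i j = ∑ a, lin (S a) A i j := by
  simp only [lin_apply, Matrix.sum_apply, Finset.sum_smul]
  rw [Finset.sum_comm]

theorem lin_one [DecidableEq α] (A : α → α → E) : lin 1 A = A := by
  funext i j
  simp [lin_apply, Matrix.one_apply, ite_smul]

theorem superMap_apply (S : Matrix (α × α) (α × α) ℂ) (X : Matrix α α ℂ) (i j : α) :
    superMap S X i j = ∑ i', ∑ j', S (i, j) (i', j') * X i' j' := rfl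

theorem superMap_sandwich (a b : Matrix α α ℂ) (X : Matrix α α ℂ) :
    superMap (sandwich a b) X = a * X * bᴴ := by
  ext i j
  simp only [superMap_apply, sandwich, Matrix.of_apply, Matrix.mul_apply, Finset.sum_mul,
    Matrix.conjTranspose_apply]
  rw [Finset.sum_comm]
  refine Finset.sum_congr rfl fun _ _ => Finset.sum_congr rfl fun _ _ => ?_
  simp only [starRingEnd_apply]
  ring

theorem superMap_sum {κ : Type*} [Fintype κ] (S : κ → Matrix (α × α) (α × α) ℂ)
    (X : Matrix α α ℂ) : superMap (∑ a, S a) X = ∑ a, superMap (S a) X := by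
  ext i j
  rw [Matrix.sum_apply]
  exact lin_sum S (fun i j => X i j) i j

theorem superMap_smul (c : ℂ) (S : Matrix (α × α) (α × α) ℂ) (X : Matrix α α ℂ) :
    superMap S (c • X) = c • superMap S X := by
  ext i j
  exact lin_smul c S (fun i j => X i j) i j

theorem smul_superMap (c : ℂ) (S : Matrix (α × α) (α × α) ℂ) (X : Matrix α α ℂ) :
    superMap (c • S) X = c • superMap S X := by
  ext i j
  exact smul_lin c S (fun i j => X i j) i j

theorem superMap_mul (S S' : Matrix (α × α) (α × α) ℂ) (X : Matrix α α ℂ) :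
    superMap (S * S') X = superMap S (superMap S' X) :=
  congrArg Matrix.of (lin_lin S S' fun i j => X i j).symm

end lin

theorem blk_lin {α : Type*} [Fintype α] {χ : ℕ} (n : ℕ) (S : Matrix (α × α) (α × α) ℂ)
    (A : LocalTensor α χ) : blk n (lin S A) = lin (spow n S) (blk n A) := by
  funext σ τ
  simp only [blk, lin_apply, list_prod_ofFn_sum, list_prod_ofFn_smul]
  rw [← (Equiv.arrowProdEquivProdArrow (Fin n) (fun _ => α) (fun _ => α)).sum_comp]
  rfl

theorem mpdo_lin {α : Type*} [Fintype α] {χ : ℕ} (S : Matrix (α × α) (α × α) ℂ)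
    (A : LocalTensor α χ) : mpdo (lin S A) = superLayer S (mpdo A) := by
  funext n
  ext σ τ
  rw [mpdo_apply, blk_lin]
  exact map_lin (Matrix.traceLinearMap (Fin χ) ℂ ℂ) _ _ _ _

theorem superLayer_smul {α : Type*} [Fintype α] (S : Matrix (α × α) (α × α) ℂ)
    {ρ ρ' : ChainState α} {n : ℕ} {c : ℂ} (h : ρ n = c • ρ' n) :
    superLayer S ρ n = c • superLayer S ρ' n := by
  rw [superLayer, superLayer, h, superMap_smul]

theorem spow_mul {α : Type*} [Fintype α] (n : ℕ) (S S' : Matrix (α × α) (α × α) ℂ) :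
    spow n (S * S') = spow n S * spow n S' := by
  ext p q
  simp only [spow, Matrix.of_apply, Matrix.mul_apply, ← Finset.prod_mul_distrib]
  rw [Finset.prod_univ_sum, Fintype.piFinset_univ,
    ← (Equiv.arrowProdEquivProdArrow (Fin n) (fun _ => α) (fun _ => α)).sum_comp]
  rfl

theorem spow_one {α : Type*} [DecidableEq α] (n : ℕ) :
    spow n (1 : Matrix (α × α) (α × α) ℂ) = 1 := by
  ext p q
  simp only [spow, Matrix.of_apply, Matrix.one_apply]
  by_cases h : p = q
  · subst h; simp
  · rw [if_neg h]
    obtain ⟨x, hx⟩ : ∃ x, (p.1 x, p.2 x) ≠ (q.1 x, q.2 x) := by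
      by_contra! hall
      exact h (Prod.ext (funext fun x => congrArg Prod.fst (hall x))
        (funext fun x => congrArg Prod.snd (hall x)))
    exact Finset.prod_eq_zero (Finset.mem_univ x) (if_neg hx)

theorem spow_smul {α : Type*} (n : ℕ) (c : ℂ) (S : Matrix (α × α) (α × α) ℂ) :
    spow n (c • S) = c ^ n • spow n S := by
  ext p q
  simp [spow, Finset.prod_mul_distrib]

theorem spow_sandwich {α : Type*} (n : ℕ) (a b : Matrix α α ℂ) :
    spow n (sandwich a b) = sandwich (tensorPow n a) (tensorPow n b) := by
  ext p q
  simp [spow, sandwich, tensorPow, Finset.prod_mul_distrib]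

theorem spow_sum {α κ : Type*} [Fintype κ] (n : ℕ) (S : κ → Matrix (α × α) (α × α) ℂ) :
    spow n (∑ a, S a) = ∑ a : Fin n → κ, Matrix.of fun p q =>
      ∏ x, S (a x) (p.1 x, p.2 x) (q.1 x, q.2 x) := by
  ext p q
  simp only [spow, Matrix.of_apply, Matrix.sum_apply]
  rw [Finset.prod_univ_sum, Fintype.piFinset_univ]

theorem sandwich_mul {α : Type*} [Fintype α] (a b a' b' : Matrix α α ℂ) :
    sandwich a b * sandwich a' b' = sandwich (a * a') (b * b') := by
  ext p q
  simp only [sandwich, Matrix.of_apply, Matrix.mul_apply, Fintype.sum_prod_type, map_sum, map_mul,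
    Finset.sum_mul_sum]
  exact Finset.sum_congr rfl fun _ _ => Finset.sum_congr rfl fun _ _ => by ring

theorem tensorPow_mul {α : Type*} [Fintype α] (n : ℕ) (a b : Matrix α α ℂ) :
    tensorPow n (a * b) = tensorPow n a * tensorPow n b := by
  ext p q
  simp only [tensorPow, Matrix.of_apply, Matrix.mul_apply, ← Finset.prod_mul_distrib]
  rw [Finset.prod_univ_sum, Fintype.piFinset_univ]

theorem tensorPow_one {α : Type*} [DecidableEq α] (n : ℕ) :
    tensorPow n (1 : Matrix α α ℂ) = 1 := by
  ext p q
  simp only [tensorPow, Matrix.of_apply, Matrix.one_apply]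
  by_cases h : p = q
  · subst h; simp
  · rw [if_neg h]
    obtain ⟨x, hx⟩ := Function.ne_iff.1 h
    exact Finset.prod_eq_zero (Finset.mem_univ x) (if_neg hx)

theorem tensorPow_conjTranspose {α : Type*} (n : ℕ) (a : Matrix α α ℂ) :
    tensorPow n aᴴ = (tensorPow n a)ᴴ := by
  ext p q
  simp [tensorPow]

/-! ### Grouping sites -/

/-- Concatenation of `n` blocks of `m` sites. -/
def concat (α : Type*) (n m : ℕ) : (Fin n → Fin m → α) ≃ (Fin (n * m) → α) :=
  (Equiv.curry _ _ _).symm.trans (Equiv.arrowCongr finProdFinEquiv (Equiv.refl α))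

theorem concat_apply {α : Type*} {n m : ℕ} (σ : Fin n → Fin m → α) (x : Fin n) (y : Fin m) :
    concat α n m σ (finProdFinEquiv (x, y)) = σ x y := by
  simp [concat, Function.uncurry]

theorem group_apply {α : Type*} (m : ℕ) (ρ : ChainState α) (n : ℕ) :
    group m ρ n = (ρ (n * m)).submatrix (concat α n m) (concat α n m) := rfl

theorem prod_concat {n m : ℕ} {M : Type*} [CommMonoid M] (f : Fin (n * m) → M) :
    ∏ s, f s = ∏ x, ∏ y, f (finProdFinEquiv (x, y)) := by
  rw [← finProdFinEquiv.prod_comp, Fintype.prod_prod_type]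

theorem blk_blk {α : Type*} {χ : ℕ} (n m : ℕ) (A : LocalTensor α χ) (σ τ : Fin n → Fin m → α) :
    blk n (blk m A) σ τ = blk (n * m) A (concat α n m σ) (concat α n m τ) := by
  simp only [blk]
  rw [List.ofFn_mul, List.prod_flatten, List.map_ofFn]
  congr 2
  funext x
  simp only [Function.comp]
  congr 2
  funext y
  have h : (⟨x * m + y, by
      calc (x : ℕ) * m + y < (x + 1) * m := by rw [add_mul, one_mul]; exact Nat.add_lt_add_left y.2 _
        _ ≤ n * m := Nat.mul_le_mul_right _ x.2⟩ : Fin (n * m)) = finProdFinEquiv (x, y) := by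
    ext
    simp [mul_comm, add_comm]
  rw [h, concat_apply, concat_apply]

theorem group_mpdo {α : Type*} {χ : ℕ} (m : ℕ) (A : LocalTensor α χ) :
    group m (mpdo A) = mpdo (blk m A) := by
  funext n
  ext σ τ
  rw [mpdo_apply, blk_blk, group_apply]
  rfl

theorem group_superLayer {α : Type*} [Fintype α] (m : ℕ) (S : Matrix (α × α) (α × α) ℂ)
    (ρ : ChainState α) : group m (superLayer S ρ) = superLayer (spow m S) (group m ρ) := by
  funext n
  ext σ τ
  rw [group_apply]
  simp only [superLayer, Matrix.submatrix_apply, superMap_apply]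
  rw [← (concat α n m).sum_comp]
  refine Finset.sum_congr rfl fun σ' _ => ?_
  rw [← (concat α n m).sum_comp]
  refine Finset.sum_congr rfl fun τ' _ => ?_
  rw [group_apply]
  simp only [spow, Matrix.of_apply, prod_concat, concat_apply, Matrix.submatrix_apply]

/-! ### The action of the doubled symmetry -/

theorem zmodTwo_cases (s : Multiplicative (ZMod 2)) : s = 1 ∨ s = Multiplicative.ofAdd 1 := by
  revert s; decide

/-- Complex conjugation of a rectangular matrix when `s` is the nontrivial element. -/
def twist {m n : Type*} (s : Multiplicative (ZMod 2)) (M : Matrix m n ℂ) : Matrix m n ℂ :=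
  if s = 1 then M else M.map conj

/-- Complex conjugation of a scalar when `s` is the nontrivial element. -/
def twistScalar (s : Multiplicative (ZMod 2)) (c : ℂ) : ℂ := if s = 1 then c else conj c

section twist

variable {m n k : Type*}

@[simp] theorem twist_one_left (M : Matrix m n ℂ) : twist 1 M = M := if_pos rfl

theorem twist_nontrivial (M : Matrix m n ℂ) : twist (Multiplicative.ofAdd 1) M = M.map conj :=
  if_neg (by decide)


theorem twistScalar_nontrivial (c : ℂ) : twistScalar (Multiplicative.ofAdd 1) c = conj c :=
  if_neg (by decide)

theorem twist_mul [Fintype n] (s : Multiplicative (ZMod 2)) (M : Matrix m n ℂ) (N : Matrix n k ℂ) :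
    twist s (M * N) = twist s M * twist s N := by
  unfold twist
  split_ifs
  · rfl
  · exact Matrix.map_mul

theorem twist_smul (s : Multiplicative (ZMod 2)) (c : ℂ) (M : Matrix m n ℂ) :
    twist s (c • M) = twistScalar s c • twist s M := by
  unfold twist twistScalar
  split_ifs
  · rfl
  · ext i j; simp

theorem twist_sum {κ : Type*} (t : Finset κ) (s : Multiplicative (ZMod 2)) (M : κ → Matrix m n ℂ) :
    twist s (∑ a ∈ t, M a) = ∑ a ∈ t, twist s (M a) := by
  unfold twist
  split_ifs
  · rfl
  · ext i j; simp [Matrix.sum_apply]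

@[simp] theorem twist_one [DecidableEq m] (s : Multiplicative (ZMod 2)) :
    twist s (1 : Matrix m m ℂ) = 1 := by
  unfold twist
  split_ifs
  · rfl
  · ext i j; simp [Matrix.one_apply]

theorem twist_twist (s t : Multiplicative (ZMod 2)) (M : Matrix m n ℂ) :
    twist s (twist t M) = twist (s * t) M := by
  rcases zmodTwo_cases s with rfl | rfl <;> rcases zmodTwo_cases t with rfl | rfl
  · simp
  · simp
  · simp
  · rw [show Multiplicative.ofAdd (1 : ZMod 2) * Multiplicative.ofAdd 1 = 1 by decide,
      twist_nontrivial, twist_nontrivial, twist_one_left]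
    ext i j; simp

theorem norm_twistScalar (s : Multiplicative (ZMod 2)) (c : ℂ) : ‖twistScalar s c‖ = ‖c‖ := by
  unfold twistScalar
  split_ifs <;> simp

theorem twistScalar_mul (s : Multiplicative (ZMod 2)) (c d : ℂ) :
    twistScalar s (c * d) = twistScalar s c * twistScalar s d := by
  unfold twistScalar
  split_ifs <;> simp

theorem twistScalar_ne_zero {s : Multiplicative (ZMod 2)} {c : ℂ} (hc : c ≠ 0) :
    twistScalar s c ≠ 0 := by
  rw [← norm_ne_zero_iff, norm_twistScalar]; exact norm_ne_zero_iff.2 hc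

theorem norm_det_twist [Fintype m] [DecidableEq m] (s : Multiplicative (ZMod 2))
    (M : Matrix m m ℂ) : ‖(twist s M).det‖ = ‖M.det‖ := by
  unfold twist
  split_ifs
  · rfl
  · have : (M.map conj).det = conj M.det := ((starRingEnd ℂ).map_det M).symm
    rw [this, RCLike.norm_conj]

/-- Complex conjugation of an invertible matrix when `s` is the nontrivial element. -/
def twistGL {χ : ℕ} (s : Multiplicative (ZMod 2)) (X : GL (Fin χ) ℂ) : GL (Fin χ) ℂ where
  val := twist s X.val
  inv := twist s (X⁻¹).val
  val_inv := by rw [← twist_mul]; simp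
  inv_val := by rw [← twist_mul]; simp

end twist

section action

variable {G K : Type*} [Group G] [Group K] {α : Type*} [Fintype α] {m n : Type*}

/-- Complex conjugation and exchange of the two physical legs when `s` is the nontrivial element. -/
def twistLegs (s : Multiplicative (ZMod 2)) (X : α → α → Matrix m n ℂ) : α → α → Matrix m n ℂ :=
  fun i j => twist s (if s = 1 then X i j else X j i)

/-- The superoperator by which a group element acts on the physical legs. -/
def symSuper (u : G × K → Matrix α α ℂ) (x : DoubledSymmetry G K) : Matrix (α × α) (α × α) ℂ :=
  sandwich (u (x.left.1, x.left.2.2)) (u (x.left.2.1, x.left.2.2))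

/-- The action of the doubled symmetry on tensors whose left and right virtual spaces may differ. On
local tensors it is `doubledAction`, by definition. -/
def rectAction (u : G × K → Matrix α α ℂ) (x : DoubledSymmetry G K) (X : α → α → Matrix m n ℂ) :
    α → α → Matrix m n ℂ := lin (symSuper u x) (twistLegs x.right X)

theorem coe_smul_circle (x : DoubledSymmetry G K) (z : Circle) :
    ((x • z : Circle) : ℂ) = twistScalar x.right z := by
  change (((if x.right = 1 then z else z⁻¹ : Circle)) : ℂ) = _
  unfold twistScalar
  split_ifs
  · rfl
  · exact Circle.coe_inv_eq_conj z

/-- The superoperator obtained by conjugating with `twistLegs`. -/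
def twistSuper (s : Multiplicative (ZMod 2)) (S : Matrix (α × α) (α × α) ℂ) :
    Matrix (α × α) (α × α) ℂ :=
  if s = 1 then S else Matrix.of fun p q => conj (S p.swap q.swap)

theorem twistLegs_lin (s : Multiplicative (ZMod 2)) (S : Matrix (α × α) (α × α) ℂ)
    (X : α → α → Matrix m n ℂ) :
    twistLegs s (lin S X) = lin (twistSuper s S) (twistLegs s X) := by
  rcases zmodTwo_cases s with rfl | rfl
  · rfl
  · funext i j
    have h : (Multiplicative.ofAdd (1 : ZMod 2)) ≠ 1 := by decide
    simp only [twistLegs, if_neg h, lin, twistSuper, twist_sum, twist_smul, twistScalar_nontrivial]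
    rw [Finset.sum_comm]
    rfl

theorem twistLegs_twistLegs {α : Type*} (s t : Multiplicative (ZMod 2)) (X : α → α → Matrix m n ℂ) :
    twistLegs s (twistLegs t X) = twistLegs (s * t) X := by
  funext i j
  have h : (Multiplicative.ofAdd (1 : ZMod 2)) ≠ 1 := by decide
  have h2 : Multiplicative.ofAdd (1 : ZMod 2) * Multiplicative.ofAdd 1 = 1 := by decide
  rcases zmodTwo_cases s with rfl | rfl <;> rcases zmodTwo_cases t with rfl | rfl
  · simp [twistLegs]
  · simp [twistLegs]
  · simp [twistLegs]
  · simp only [twistLegs, if_neg h, twist_twist, h2, if_true]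

/-- The superoperators compose like the elements of the semidirect product: moving the exchange of the
physical legs past a superoperator swaps the two copies of the strong symmetry. -/
theorem symSuper_mul {u : G × K → Matrix α α ℂ} (hu : ∀ p q, u (p * q) = u p * u q)
    (x y : DoubledSymmetry G K) :
    symSuper u x * twistSuper x.right (symSuper u y) = symSuper u (x * y) := by
  have hl : ∀ s, swapHom G K s = if s = 1 then 1 else swapAut G K := fun s => rfl
  by_cases hx : x.right = 1
  · simp only [symSuper, twistSuper, hx, if_true, sandwich_mul, ← hu, SemidirectProduct.mul_left,
      hl]
    rfl
  · have : twistSuper x.right (symSuper u y) =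
        sandwich (u (y.left.2.1, y.left.2.2)) (u (y.left.1, y.left.2.2)) := by
      ext p q
      simp [twistSuper, hx, symSuper, sandwich, mul_comm]
    rw [this]
    simp only [symSuper, hx, if_false, sandwich_mul, ← hu, SemidirectProduct.mul_left, hl]
    rfl

theorem rectAction_rectAction {u : G × K → Matrix α α ℂ} (hu : ∀ p q, u (p * q) = u p * u q)
    (x y : DoubledSymmetry G K) (X : α → α → Matrix m n ℂ) :
    rectAction u x (rectAction u y X) = rectAction u (x * y) X := by
  rw [rectAction, rectAction, twistLegs_lin, lin_lin, symSuper_mul hu, twistLegs_twistLegs]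
  rfl

theorem rectAction_mul_mul {m' n' : Type*} [Fintype m] [Fintype n] (u : G × K → Matrix α α ℂ)
    (x : DoubledSymmetry G K) (P : Matrix m' m ℂ) (X : α → α → Matrix m n ℂ) (Q : Matrix n n' ℂ)
    (i j : α) :
    rectAction u x (fun i j => P * X i j * Q) i j =
      twist x.right P * rectAction u x X i j * twist x.right Q := by
  have : twistLegs x.right (fun i j => P * X i j * Q) =
      fun i j => twist x.right P * twistLegs x.right X i j * twist x.right Q := by
    funext i j
    simp only [twistLegs]
    split_ifs <;> rw [twist_mul, twist_mul]
  rw [rectAction, this]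
  simp only [lin, Matrix.mul_sum, Matrix.sum_mul, Matrix.mul_smul, Matrix.smul_mul, rectAction]

theorem rectAction_smul (u : G × K → Matrix α α ℂ) (x : DoubledSymmetry G K) (c : ℂ)
    (X : α → α → Matrix m n ℂ) (i j : α) :
    rectAction u x (fun i j => c • X i j) i j = twistScalar x.right c • rectAction u x X i j := by
  have : twistLegs x.right (fun i j => c • X i j) =
      fun i j => twistScalar x.right c • twistLegs x.right X i j := by
    funext i j
    simp only [twistLegs]
    split_ifs <;> rw [twist_smul]
  rw [rectAction, this, lin_smul]
  rfl

theorem blk_twistLegs {α : Type*} {χ : ℕ} (k : ℕ) (s : Multiplicative (ZMod 2)) (A : LocalTensor α χ) :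
    blk k (twistLegs s A) = twistLegs s (blk k A) := by
  funext σ τ
  have key : ∀ l : List (Matrix (Fin χ) (Fin χ) ℂ),
      (l.map (twist s)).prod = twist s l.prod := by
    intro l
    induction l with
    | nil => simp
    | cons a l ih => simp [ih, twist_mul]
  simp only [blk, twistLegs]
  split_ifs <;> rw [← key, List.map_ofFn] <;> rfl

theorem spow_symSuper {α : Type*} (k : ℕ) (u : G × K → Matrix α α ℂ) (x : DoubledSymmetry G K) :
    spow k (symSuper u x) = symSuper (fun p => tensorPow k (u p)) x := spow_sandwich _ _ _

theorem blk_rectAction {χ : ℕ} (k : ℕ) (u : G × K → Matrix α α ℂ) (x : DoubledSymmetry G K)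
    (A : LocalTensor α χ) :
    blk k (rectAction u x A) = rectAction (fun p => tensorPow k (u p)) x (blk k A) := by
  rw [rectAction, blk_lin, blk_twistLegs, spow_symSuper]
  rfl

end action

/-! ### Projective symmetries of a local tensor -/

/-- The tensor as a family of matrices indexed by pairs of physical indices. -/
def flatTensor {α : Type*} {χ : ℕ} (A : LocalTensor α χ) : α × α → Matrix (Fin χ) (Fin χ) ℂ :=
  fun p => A p.1 p.2

/-- A tensor is injective iff its matrices span the matrix algebra. -/
theorem injective_tensorMap_iff {α : Type*} {χ : ℕ} (A : LocalTensor α χ) :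
    Function.Injective (tensorMap A) ↔ SpansMatrices (flatTensor A) := by
  have key : ∀ X p, tensorMap A X p = (Xᵀ * flatTensor A p).trace := by
    intro X p
    simp only [tensorMap, flatTensor, Matrix.trace, Matrix.diag, Matrix.mul_apply,
      Matrix.transpose_apply]
    rw [Finset.sum_comm]
    exact Finset.sum_congr rfl fun _ _ => Finset.sum_congr rfl fun _ _ => mul_comm _ _
  rw [spansMatrices_iff]
  constructor
  · intro h Z hZ
    have : Zᵀ = 0 := h (funext fun p => by
      rw [key, key, Matrix.transpose_transpose, hZ]; simp)
    simpa using this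
  · intro h X Y hXY
    have := h (X - Y)ᵀ fun p => by
      have := congrFun hXY p
      rw [key, key] at this
      rw [Matrix.transpose_sub, Matrix.sub_mul, Matrix.trace_sub, this, sub_self]
    rw [← sub_eq_zero]
    simpa only [Matrix.transpose_transpose, Matrix.transpose_zero] using
      congrArg Matrix.transpose this

section spans

variable {α : Type*} {χ : ℕ}

theorem SpansMatrices.lin [Fintype α] [DecidableEq α] {A : LocalTensor α χ}
    (hA : SpansMatrices (flatTensor A)) {S : Matrix (α × α) (α × α) ℂ} (hS : IsUnit S) :
    SpansMatrices (flatTensor (MixedSPT.lin S A)) := by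
  rw [spansMatrices_iff]
  intro Z hZ
  refine hA.eq_zero fun p => ?_
  have h0 : MixedSPT.lin S (fun i j => (Z * A i j).trace) = fun _ _ => 0 := by
    funext i j
    rw [← hZ (i, j)]
    exact (map_lin ((Matrix.traceLinearMap (Fin χ) ℂ ℂ) ∘ₗ (LinearMap.mulLeft ℂ Z)) S A i j).symm
  obtain ⟨T, hT⟩ := hS.exists_left_inv
  have h1 := congrArg (MixedSPT.lin T) h0
  rw [lin_lin, hT, lin_one] at h1
  have h2 := congrFun (congrFun h1 p.1) p.2
  simpa [MixedSPT.lin, flatTensor] using h2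

theorem SpansMatrices.twistLegs {A : LocalTensor α χ} (hA : SpansMatrices (flatTensor A))
    (s : Multiplicative (ZMod 2)) : SpansMatrices (flatTensor (twistLegs s A)) := by
  rcases zmodTwo_cases s with rfl | rfl
  · have : MixedSPT.twistLegs 1 A = A := by funext i j; simp [MixedSPT.twistLegs]
    rw [this]
    exact hA
  · rw [spansMatrices_iff]
    intro Z hZ
    have : Z.map conj = 0 := hA.eq_zero fun p => by
      have h := hZ p.swap
      have h' : (Z * (A p.1 p.2).map conj).trace = 0 := h
      have h2 := congrArg conj h'
      rw [map_zero] at h2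
      rw [← h2]
      simp [Matrix.trace, Matrix.mul_apply, flatTensor]
    ext i j
    have := congrFun (congrFun this i) j
    simpa using this

theorem SpansMatrices.blk {A : LocalTensor α χ} (hA : SpansMatrices (flatTensor A)) {k : ℕ}
    (hk : 0 < k) : SpansMatrices (flatTensor (blk k A)) := by
  induction k, hk using Nat.le_induction with
  | base =>
    rw [spansMatrices_iff]
    intro Z hZ
    refine hA.eq_zero fun p => ?_
    simpa [flatTensor, MixedSPT.blk] using hZ (fun _ => p.1, fun _ => p.2)
  | succ k _ ih =>
    rw [spansMatrices_iff]
    intro Z hZ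
    have h1 : ∀ σ τ, MixedSPT.blk k A σ τ * Z = 0 := by
      intro σ τ
      refine hA.eq_zero fun p => ?_
      have := hZ (Fin.cons p.1 σ, Fin.cons p.2 τ)
      rw [flatTensor, MixedSPT.blk, List.ofFn_succ, List.prod_cons] at this
      simp only [Fin.cons_zero, Fin.cons_succ] at this
      rw [mul_assoc, Matrix.trace_mul_comm, mul_assoc]
      exact this
    have h2 : ∀ W, Z * W = 0 := by
      intro W
      refine ih.eq_zero fun p => ?_
      rw [Matrix.trace_mul_comm, ← mul_assoc, flatTensor, h1, zero_mul, Matrix.trace_zero]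
    simpa using h2 1

theorem mpdo_two (A : LocalTensor α χ) (p q : α × α) :
    mpdo A 2 ![p.1, q.1] ![p.2, q.2] = (flatTensor A p * flatTensor A q).trace := by
  simp [mpdo, flatTensor, List.ofFn_succ]

theorem mpdo_three (A : LocalTensor α χ) (p q r : α × α) :
    mpdo A 3 ![p.1, q.1, r.1] ![p.2, q.2, r.2] =
      (flatTensor A p * flatTensor A q * flatTensor A r).trace := by
  simp [mpdo, flatTensor, List.ofFn_succ, mul_assoc]

end spans

section symmetry

variable {G K : Type} [Group G] [Group K]

/-- The projective representation `V` with phases `θ` and factor system `ω` implements the symmetry of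
the tensor `A` on its virtual space. -/
structure IsProjSymmetry {α : Type*} [Fintype α] {χ : ℕ} (u : G × K → Matrix α α ℂ)
    (A : LocalTensor α χ) (V : DoubledSymmetry G K → GL (Fin χ) ℂ) (θ : DoubledSymmetry G K → Circle)
    (ω : DoubledSymmetry G K × DoubledSymmetry G K → Circle) : Prop where
  act : ∀ x i j, rectAction u x A i j =
    (θ x : ℂ) • (((V x)⁻¹ : GL (Fin χ) ℂ).val * A i j * (V x).val)
  mul : ∀ x y, (V x).val * twist x.right (V y).val = (ω (x, y) : ℂ) • (V (x * y)).val

theorem hasTensorClass_iff {α : Type*} [Fintype α] {χ : ℕ} {u : G × K → Matrix α α ℂ}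
    {A : LocalTensor α χ} {c : SPTClass G K} :
    HasTensorClass u A c ↔ ∃ V θ ω, IsProjSymmetry u A V θ ω ∧
      ∃ h : groupCohomology.IsMulCocycle₂ ω,
        groupCohomology.H2π (Rep.ofMulDistribMulAction (DoubledSymmetry G K) Circle)
          (groupCohomology.cocyclesOfIsMulCocycle₂ h) = c :=
  ⟨fun ⟨V, θ, ω, h1, h2, h3⟩ => ⟨V, θ, ω, ⟨h1, h2⟩, h3⟩,
    fun ⟨V, θ, ω, ⟨h1, h2⟩, h3⟩ => ⟨V, θ, ω, h1, h2, h3⟩⟩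

/-- The factor system of a projective representation is a cocycle. -/
theorem isMulCocycle₂_of_mul {χ : ℕ} (hχ : 0 < χ) {V : DoubledSymmetry G K → GL (Fin χ) ℂ}
    {ω : DoubledSymmetry G K × DoubledSymmetry G K → Circle}
    (h : ∀ x y, (V x).val * twist x.right (V y).val = (ω (x, y) : ℂ) • (V (x * y)).val) :
    groupCohomology.IsMulCocycle₂ ω := by
  have : Nonempty (Fin χ) := ⟨⟨0, hχ⟩⟩
  intro x y z
  apply Circle.coe_injective
  rw [Circle.coe_mul, Circle.coe_mul, coe_smul_circle]
  have e1 : (V x).val * twist x.right ((V y).val * twist y.right (V z).val) =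
      (twistScalar x.right (ω (y, z)) * ω (x, y * z)) • (V (x * y * z)).val := by
    rw [h, twist_smul, Matrix.mul_smul, h, smul_smul, mul_assoc]
  have e2 : (V x).val * twist x.right ((V y).val * twist y.right (V z).val) =
      ((ω (x * y, z) : ℂ) * ω (x, y)) • (V (x * y * z)).val := by
    rw [twist_mul, twist_twist, ← mul_assoc, h, Matrix.smul_mul, ← SemidirectProduct.mul_right, h,
      smul_smul, mul_comm]
  exact smul_left_injective ℂ (V (x * y * z)).ne_zero (e2.symm.trans e1)

/-- Factor systems that differ by a coboundary with values in `ℂˣ` have the same class in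
`H²(-, U_T(1))`, because the cochain can be divided by its modulus. -/
theorem H2π_eq_of_mul {ω ω' : DoubledSymmetry G K × DoubledSymmetry G K → Circle}
    (h : groupCohomology.IsMulCocycle₂ ω) (h' : groupCohomology.IsMulCocycle₂ ω')
    (b : DoubledSymmetry G K → ℂ) (hb : ∀ x, b x ≠ 0)
    (hω : ∀ x y, (ω (x, y) : ℂ) * b (x * y) = twistScalar x.right (b y) * b x * ω' (x, y)) :
    groupCohomology.H2π (Rep.ofMulDistribMulAction (DoubledSymmetry G K) Circle)
        (groupCohomology.cocyclesOfIsMulCocycle₂ h) =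
      groupCohomology.H2π (Rep.ofMulDistribMulAction (DoubledSymmetry G K) Circle)
        (groupCohomology.cocyclesOfIsMulCocycle₂ h') := by
  rw [groupCohomology.H2π_eq_iff]
  let β : DoubledSymmetry G K → Circle := fun x => Circle.exp (Complex.arg (b x))
  have hβ : ∀ x, b x = (‖b x‖ : ℂ) * β x := fun x => by
    rw [Circle.coe_exp, Complex.norm_mul_exp_arg_mul_I]
  have hcob : groupCohomology.IsMulCoboundary₂ (fun p => ω p / ω' p) := by
    refine ⟨β, fun x y => ?_⟩
    have e := hω x y
    have en : ‖b (x * y)‖ = ‖b y‖ * ‖b x‖ := by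
      have := congrArg norm e
      rw [norm_mul, norm_mul, norm_mul, norm_twistScalar, Circle.norm_coe, Circle.norm_coe] at this
      simpa using this
    rw [hβ (x * y), hβ x, hβ y, en, twistScalar_mul] at e
    have hr : twistScalar x.right (‖b y‖ : ℂ) = ‖b y‖ := by
      unfold twistScalar
      split_ifs <;> simp
    rw [hr] at e
    have n1 : (‖b y‖ : ℂ) ≠ 0 := by simpa using hb y
    have n2 : (‖b x‖ : ℂ) ≠ 0 := by simpa using hb x
    have e' : (ω (x, y) : ℂ) * β (x * y) = twistScalar x.right (β y) * β x * ω' (x, y) := by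
      apply mul_left_cancel₀ (mul_ne_zero n1 n2)
      push_cast at e
      linear_combination e
    rw [← coe_smul_circle] at e'
    have e'' : ω (x, y) * β (x * y) = x • β y * β x * ω' (x, y) :=
      Circle.coe_injective (by push_cast; exact e')
    change _ = ω (x, y) / ω' (x, y)
    rw [eq_div_iff_mul_eq', div_mul_eq_mul_div, div_mul_eq_mul_div, div_eq_iff_eq_mul, e'']
  exact (groupCohomology.coboundariesOfIsMulCoboundary₂ hcob).2

/-- Injective tensors that are related by a conjugation and a scalar carry the same class. -/
theorem IsProjSymmetry.H2π_eq {α : Type*} [Fintype α] {χ : ℕ} (hχ : 0 < χ)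
    {u : G × K → Matrix α α ℂ} {A B : LocalTensor α χ} (hA : SpansMatrices (flatTensor A))
    {V V' : DoubledSymmetry G K → GL (Fin χ) ℂ} {θ θ' : DoubledSymmetry G K → Circle}
    {ω ω' : DoubledSymmetry G K × DoubledSymmetry G K → Circle}
    (hV : IsProjSymmetry u A V θ ω) (hV' : IsProjSymmetry u B V' θ' ω')
    {X : GL (Fin χ) ℂ} {t : ℂ} (ht : t ≠ 0) (hB : ∀ i j, B i j = t • ((X⁻¹).val * A i j * X.val))
    (h : groupCohomology.IsMulCocycle₂ ω) (h' : groupCohomology.IsMulCocycle₂ ω') :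
    groupCohomology.H2π (Rep.ofMulDistribMulAction (DoubledSymmetry G K) Circle)
        (groupCohomology.cocyclesOfIsMulCocycle₂ h) =
      groupCohomology.H2π (Rep.ofMulDistribMulAction (DoubledSymmetry G K) Circle)
        (groupCohomology.cocyclesOfIsMulCocycle₂ h') := by
  have : Nonempty (Fin χ) := ⟨⟨0, hχ⟩⟩
  -- `Z = V_x ˣX V'_x⁻¹ X⁻¹` commutes with the tensor up to a scalar, hence is a scalar
  have key : ∀ x, ∃ b : ℂ, b ≠ 0 ∧
      (V x).val * twist x.right X.val = b • (X.val * (V' x).val) := by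
    intro x
    let Xx := twistGL x.right X
    have hXx : Xx.val = twist x.right X.val := rfl
    have hXx' : (Xx⁻¹).val = twist x.right (X⁻¹).val := rfl
    have e : ∀ p : α × α, twistScalar x.right t • ((Xx⁻¹).val * ((θ x : ℂ) •
        (((V x)⁻¹).val * flatTensor A p * (V x).val)) * Xx.val) =
        (θ' x : ℂ) • (((V' x)⁻¹).val * (t • ((X⁻¹).val * flatTensor A p * X.val)) *
          (V' x).val) := by
      intro p
      have hBf : B = fun i j => t • ((X⁻¹).val * A i j * X.val) := by
        funext i j; exact hB i j
      have h1 := hV'.act x p.1 p.2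
      rw [hB p.1 p.2] at h1
      rw [flatTensor, ← h1, ← hV.act x, hBf,
        rectAction_smul u x t (fun i j => (X⁻¹).val * A i j * X.val), rectAction_mul_mul]
      rfl
    let Z : GL (Fin χ) ℂ := V x * Xx * (V' x)⁻¹ * X⁻¹
    obtain ⟨b, hb, hZ⟩ := hA.exists_scalar hχ (Z := Z.val) (Units.isUnit Z)
      (s := (twistScalar x.right t * θ x)⁻¹ * (θ' x * t)) (fun p => by
        have h0 : twistScalar x.right t * (θ x : ℂ) ≠ 0 :=
          mul_ne_zero (twistScalar_ne_zero ht) (Circle.coe_ne_zero _)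
        have e1 := e p
        simp only [Matrix.mul_smul, Matrix.smul_mul, smul_smul] at e1
        have e2 := congrArg (fun M => (V x).val * (Xx.val * M * ((V' x)⁻¹).val) * (X⁻¹).val) e1
        simp only [Matrix.mul_smul, Matrix.smul_mul] at e2
        have c1 : (V x).val * (Xx.val * ((Xx⁻¹).val * (((V x)⁻¹).val * flatTensor A p *
            (V x).val) * Xx.val) * ((V' x)⁻¹).val) * (X⁻¹).val = flatTensor A p * Z.val := by
          simp [Z, mul_assoc]
        have c2 : (V x).val * (Xx.val * (((V' x)⁻¹).val * ((X⁻¹).val * flatTensor A p * X.val) *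
            (V' x).val) * ((V' x)⁻¹).val) * (X⁻¹).val = Z.val * flatTensor A p := by
          simp [Z, mul_assoc]
        rw [c1, c2] at e2
        rw [mul_smul, ← e2, smul_smul, inv_mul_cancel₀ h0, one_smul])
    refine ⟨b, hb, ?_⟩
    have := congrArg (fun M => M * X.val * (V' x).val) hZ
    simpa [Z, mul_assoc, hXx] using this
  choose b hb hbV using key
  refine H2π_eq_of_mul h h' b hb fun x y => ?_
  have e1 : (V x).val * twist x.right ((V y).val * twist y.right X.val) =
      ((ω (x, y) : ℂ) * b (x * y)) • (X.val * (V' (x * y)).val) := by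
    rw [twist_mul, twist_twist, ← mul_assoc, hV.mul, Matrix.smul_mul,
      ← SemidirectProduct.mul_right, hbV, smul_smul]
  have e2 : (V x).val * twist x.right ((V y).val * twist y.right X.val) =
      (twistScalar x.right (b y) * b x * ω' (x, y)) • (X.val * (V' (x * y)).val) := by
    rw [hbV, twist_smul, twist_mul, Matrix.mul_smul, ← mul_assoc, hbV, Matrix.smul_mul, mul_assoc,
      hV'.mul, Matrix.mul_smul, smul_smul, smul_smul]
  have hne : X.val * (V' (x * y)).val ≠ 0 := (X * V' (x * y)).ne_zero
  exact smul_left_injective ℂ hne (e1.symm.trans e2)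

end symmetry

/-! ### Strong injective tensors and their blocks -/

section strong

variable {α : Type*} [Fintype α] {χ : ℕ}

theorem IsStrongInjective.spans {A : LocalTensor α χ} (h : IsStrongInjective A) :
    SpansMatrices (flatTensor A) := (injective_tensorMap_iff A).1 h.injective

/-- The dominant eigenvalue of the transfer matrix is nonzero: otherwise the operator on a ring of one
site is positive semidefinite with vanishing trace, so that the tensor is traceless. -/
theorem IsStrongInjective.exists_isDominant {A : LocalTensor α χ} (h : IsStrongInjective A) :
    ∃ r : ℝ, r ≠ 0 ∧ IsDominant (transfer A) r := by
  obtain ⟨r, hr⟩ := h.transfer_gap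
  refine ⟨r, ?_, hr⟩
  rintro rfl
  have hr' : IsDominant (transfer A) 0 := hr
  have : Nonempty (Fin χ) := ⟨⟨0, hr'.dim_pos⟩⟩
  classical
  have h0 : mpdo A 1 = 0 := by
    rw [← (h.posSemidef 1 one_pos).trace_eq_zero_iff]
    have := hr'.trace_eq_zero
    rw [transfer, Matrix.trace_sum] at this
    rw [Matrix.trace, ← (Equiv.funUnique (Fin 1) α).symm.sum_comp, ← this]
    simp [mpdo]
  have h1 : (1 : Matrix (Fin χ) (Fin χ) ℂ) = 0 := h.spans.eq_zero fun p => by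
    have := congrFun (congrFun h0 fun _ => p.1) fun _ => p.2
    simpa [mpdo, flatTensor] using this
  exact one_ne_zero h1

theorem IsStrongInjective.dim_pos {A : LocalTensor α χ} (h : IsStrongInjective A) : 0 < χ :=
  let ⟨_, _, hr⟩ := h.exists_isDominant
  hr.dim_pos

theorem transfer_blk (k : ℕ) (A : LocalTensor α χ) : transfer (blk k A) = transfer A ^ k := by
  have h := list_prod_ofFn_sum (n := k) fun (_ : Fin k) (i : α) => A i i
  rw [List.ofFn_const, List.prod_replicate] at h
  exact h.symm

theorem posSemidef_group {α : Type*} {ρ : ChainState α} (h : ∀ n, 0 < n → (ρ n).PosSemidef) {k : ℕ}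
    (hk : 0 < k) (n : ℕ) (hn : 0 < n) : (group k ρ n).PosSemidef :=
  (h (n * k) (Nat.mul_pos hn hk)).submatrix _

theorem IsStrongInjective.blk {A : LocalTensor α χ} (h : IsStrongInjective A) {k : ℕ} (hk : 0 < k) :
    IsStrongInjective (blk k A) where
  posSemidef n hn := by
    rw [← group_mpdo]
    exact posSemidef_group h.posSemidef hk n hn
  injective := (injective_tensorMap_iff _).2 (h.spans.blk hk)
  transfer_gap := by
    obtain ⟨r, hr, hd⟩ := h.exists_isDominant
    exact ⟨r ^ k, by rw [transfer_blk]; exact hd.pow hr hk⟩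

theorem Represents.blk {α : Type*} {A : LocalTensor α χ} {ρ : ChainState α} (h : Represents A ρ) {k : ℕ}
    (hk : 0 < k) : Represents (blk k A) (group k ρ) := by
  intro n hn
  obtain ⟨s, hs, e⟩ := h (n * k) (Nat.mul_pos hn hk)
  refine ⟨s, hs, ?_⟩
  rw [← group_mpdo, group_apply, group_apply, e]
  rfl

theorem blk_conj {α : Type*} (k : ℕ) (A : LocalTensor α χ) (t : ℂ) (X : GL (Fin χ) ℂ) (σ τ : Fin k → α) :
    blk k (fun i j => t • ((X⁻¹).val * A i j * X.val)) σ τ =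
      t ^ k • ((X⁻¹).val * blk k A σ τ * X.val) := by
  induction k with
  | zero => simp [MixedSPT.blk]
  | succ k ih =>
    have := ih (fun x => σ x.succ) (fun x => τ x.succ)
    simp only [MixedSPT.blk] at this
    simp only [MixedSPT.blk, List.ofFn_succ, List.prod_cons]
    rw [this, smul_mul_smul_comm, pow_succ']
    congr 1
    simp [mul_assoc]

variable {G K : Type} [Group G] [Group K]

theorem IsProjSymmetry.blk {u : G × K → Matrix α α ℂ} {A : LocalTensor α χ}
    {V : DoubledSymmetry G K → GL (Fin χ) ℂ} {θ : DoubledSymmetry G K → Circle}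
    {ω : DoubledSymmetry G K × DoubledSymmetry G K → Circle} (h : IsProjSymmetry u A V θ ω) (k : ℕ) :
    IsProjSymmetry (fun p => tensorPow k (u p)) (blk k A) V (fun x => θ x ^ k) ω where
  act x σ τ := by
    rw [← blk_rectAction, show rectAction u x A = _ from funext fun i => funext fun j => h.act x i j,
      blk_conj, Circle.coe_pow]
  mul := h.mul

end strong

/-! ### Classes of families of operators -/

section gen

variable {G K : Type} [Group G] [Group K]

/-- The family `ρ` is, without grouping sites, generated by a strong injective tensor of class `c`. -/
def GeneratedInClass {α : Type*} [Fintype α] (u : G × K → Matrix α α ℂ) (ρ : ChainState α)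
    (c : SPTClass G K) : Prop :=
  ∃ (χ : ℕ) (B : LocalTensor α χ), IsStrongInjective B ∧ Represents B ρ ∧ HasTensorClass u B c

theorem hasSPTClass_iff {α : Type*} [Fintype α] {u : G × K → Matrix α α ℂ} {ρ : ChainState α}
    {c : SPTClass G K} : HasSPTClass u ρ c ↔
      ∃ m, 0 < m ∧ GeneratedInClass (fun p => tensorPow m (u p)) (group m ρ) c := Iff.rfl

theorem HasTensorClass.blk {α : Type*} [Fintype α] {χ : ℕ} {u : G × K → Matrix α α ℂ}
    {A : LocalTensor α χ} {c : SPTClass G K} (h : HasTensorClass u A c) (k : ℕ) :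
    HasTensorClass (fun p => tensorPow k (u p)) (blk k A) c := by
  rw [hasTensorClass_iff] at h ⊢
  obtain ⟨V, θ, ω, h1, h2⟩ := h
  exact ⟨V, _, ω, h1.blk k, h2⟩

theorem GeneratedInClass.group {α : Type*} [Fintype α] {u : G × K → Matrix α α ℂ}
    {ρ : ChainState α} {c : SPTClass G K} (h : GeneratedInClass u ρ c) {k : ℕ} (hk : 0 < k) :
    GeneratedInClass (fun p => tensorPow k (u p)) (group k ρ) c := by
  obtain ⟨χ, B, h1, h2, h3⟩ := h
  exact ⟨χ, blk k B, h1.blk hk, h2.blk hk, h3.blk k⟩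

/-- The class of a family does not depend on the generating tensor. -/
theorem GeneratedInClass.unique {α : Type*} [Fintype α] {u : G × K → Matrix α α ℂ}
    {ρ : ChainState α} {c c' : SPTClass G K} (h : GeneratedInClass u ρ c)
    (h' : GeneratedInClass u ρ c') : c = c' := by
  obtain ⟨χ, A, hA, hAρ, hAc⟩ := h
  obtain ⟨χ', B, hB, hBρ, hBc⟩ := h'
  have key : ∀ n, 0 < n → ∃ s : ℂ, s ≠ 0 ∧ ∀ σ τ, mpdo A n σ τ = s * mpdo B n σ τ := by
    intro n hn
    obtain ⟨s, hs, e⟩ := hAρ n hn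
    obtain ⟨s', hs', e'⟩ := hBρ n hn
    have hsc : (s : ℂ) ≠ 0 := by exact_mod_cast hs.ne'
    have hsc' : (s' : ℂ) ≠ 0 := by exact_mod_cast hs'.ne'
    refine ⟨(s : ℂ)⁻¹ * s', mul_ne_zero (inv_ne_zero hsc) hsc', fun σ τ => ?_⟩
    have := congrFun (congrFun (e.symm.trans e') σ) τ
    simp only [Matrix.smul_apply, smul_eq_mul] at this
    rw [mul_assoc, ← this, inv_mul_cancel_left₀ hsc]
  obtain ⟨s₂, hs₂, k₂⟩ := key 2 two_pos
  obtain ⟨s₃, hs₃, k₃⟩ := key 3 three_pos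
  have f₂ : ∀ p q, (flatTensor A p * flatTensor A q).trace =
      s₂ * (flatTensor B p * flatTensor B q).trace := by
    intro p q
    rw [← mpdo_two, ← mpdo_two, k₂]
  have f₃ : ∀ p q r, (flatTensor A p * flatTensor A q * flatTensor A r).trace =
      s₃ * (flatTensor B p * flatTensor B q * flatTensor B r).trace := by
    intro p q r
    rw [← mpdo_three, ← mpdo_three, k₃]
  obtain rfl := hA.spans.dim_eq hB.spans hs₂ f₂ f₃
  obtain ⟨X, t, ht, hX⟩ := hA.spans.exists_conj hB.spans hs₂ hs₃ f₂ f₃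
  rw [hasTensorClass_iff] at hAc hBc
  obtain ⟨V, θ, ω, hV, hω, rfl⟩ := hAc
  obtain ⟨V', θ', ω', hV', hω', rfl⟩ := hBc
  exact hV.H2π_eq hA.dim_pos hA.spans hV' ht (fun i j => hX (i, j)) hω hω'

/-- Renaming the basis of the local Hilbert space. -/
theorem GeneratedInClass.relabel {α β : Type*} [Fintype α] [Fintype β] {u : G × K → Matrix α α ℂ}
    {ρ : ChainState α} {c : SPTClass G K} (h : GeneratedInClass u ρ c) (e : β ≃ α) :
    GeneratedInClass (fun p => (u p).submatrix e e)
      (fun n => (ρ n).submatrix (fun σ x => e (σ x)) (fun σ x => e (σ x))) c := by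
  obtain ⟨χ, B, hB, hρ, hc⟩ := h
  let B' : LocalTensor β χ := fun i j => B (e i) (e j)
  have hm : ∀ n, mpdo B' n = (mpdo B n).submatrix (fun σ x => e (σ x)) (fun σ x => e (σ x)) :=
    fun n => rfl
  refine ⟨χ, B', ⟨fun n hn => ?_, ?_, ?_⟩, fun n hn => ?_, ?_⟩
  · rw [hm]
    exact (hB.posSemidef n hn).submatrix _
  · intro X Y hXY
    apply hB.injective
    funext p
    have := congrFun hXY (e.symm p.1, e.symm p.2)
    simpa [tensorMap, B'] using this
  · have : transfer B' = transfer B := e.sum_comp fun i => B i i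
    rw [this]
    exact hB.transfer_gap
  · obtain ⟨s, hs, h⟩ := hρ n hn
    refine ⟨s, hs, ?_⟩
    simp only [hm, h]
    rfl
  · rw [hasTensorClass_iff] at hc ⊢
    obtain ⟨V, θ, ω, hV, hω⟩ := hc
    refine ⟨V, θ, ω, ⟨fun x i j => ?_, hV.mul⟩, hω⟩
    have : rectAction (fun p => (u p).submatrix e e) x B' i j = rectAction u x B (e i) (e j) := by
      simp only [rectAction, lin]
      rw [← e.sum_comp]
      refine Finset.sum_congr rfl fun i' _ => ?_
      rw [← e.sum_comp]
      rfl
    rw [this]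
    exact hV.act x (e i) (e j)

theorem chainState_cast {α : Type*} (ρ : ChainState α) {a b : ℕ} (h : a = b) (σ τ : Fin a → α) :
    ρ a σ τ = ρ b (fun s => σ (Fin.cast h.symm s)) (fun s => τ (Fin.cast h.symm s)) := by
  subst h; rfl

/-- Concatenating blocks in two steps gives the same chain, up to the associativity of its length. -/
theorem concat_concat {α : Type*} (n k m : ℕ) (σ : Fin n → Fin k → Fin m → α)
    (h : n * k * m = n * (k * m)) :
    (fun s => concat α (n * k) m (concat (Fin m → α) n k σ) (Fin.cast h.symm s)) =
      concat α n (k * m) (fun x => concat α k m (σ x)) := by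
  funext s
  obtain ⟨⟨x, t⟩, rfl⟩ := finProdFinEquiv.surjective s
  obtain ⟨⟨y, z⟩, rfl⟩ := finProdFinEquiv.surjective t
  have : Fin.cast h.symm (finProdFinEquiv (x, finProdFinEquiv (y, z))) =
      finProdFinEquiv (finProdFinEquiv (x, y), z) := by
    ext
    simp
    ring
  rw [this, concat_apply, concat_apply, concat_apply, concat_apply]

/-- Grouping twice is grouping once. -/
theorem GeneratedInClass.of_group_group {α : Type*} [Fintype α] {u : G × K → Matrix α α ℂ}
    {ρ : ChainState α} {c : SPTClass G K} {k m : ℕ}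
    (h : GeneratedInClass (fun p => tensorPow k (tensorPow m (u p)))
      (MixedSPT.group k (MixedSPT.group m ρ)) c) :
    GeneratedInClass (fun p => tensorPow (k * m) (u p)) (MixedSPT.group (k * m) ρ) c := by
  have h' := h.relabel (concat α k m).symm
  have e1 : (fun p => (tensorPow k (tensorPow m (u p))).submatrix (concat α k m).symm
      (concat α k m).symm) = fun p => tensorPow (k * m) (u p) := by
    funext p
    ext σ τ
    obtain ⟨σ, rfl⟩ := (concat α k m).surjective σ
    obtain ⟨τ, rfl⟩ := (concat α k m).surjective τ
    simp [tensorPow, prod_concat, concat_apply]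
  have e2 : (fun n => (MixedSPT.group k (MixedSPT.group m ρ) n).submatrix
      (fun σ x => (concat α k m).symm (σ x)) (fun σ x => (concat α k m).symm (σ x))) =
      MixedSPT.group (k * m) ρ := by
    funext n
    ext σ τ
    simp only [group_apply, Matrix.submatrix_apply]
    rw [chainState_cast ρ (mul_assoc n k m), concat_concat _ _ _ _ (mul_assoc n k m),
      concat_concat _ _ _ _ (mul_assoc n k m)]
    simp
  rw [e1, e2] at h'
  exact h'

/-- A family has at most one class. -/
theorem HasSPTClass.unique {α : Type*} [Fintype α] {u : G × K → Matrix α α ℂ} {ρ : ChainState α}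
    {c c' : SPTClass G K} (h : HasSPTClass u ρ c) (h' : HasSPTClass u ρ c') : c = c' := by
  obtain ⟨m, hm, h⟩ := hasSPTClass_iff.1 h
  obtain ⟨m', hm', h'⟩ := hasSPTClass_iff.1 h'
  have e := (h.group hm').of_group_group
  have e' := (h'.group hm).of_group_group
  rw [mul_comm] at e'
  exact e.unique e'

end gen

/-! ### Symmetric injective tensors have a class -/

section exist

variable {G K : Type} [Group G] [Group K] {α : Type*} [Fintype α] {χ : ℕ}

/-- An invertible matrix can be rescaled to a determinant of modulus one. -/
theorem exists_rescale {χ : ℕ} (X : GL (Fin χ) ℂ) : ∃ (Y : GL (Fin χ) ℂ) (r : ℂ), r ≠ 0 ∧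
    Y.val = r • X.val ∧ (Y⁻¹).val = r⁻¹ • (X⁻¹).val ∧ ‖Y.val.det‖ = 1 := by
  rcases Nat.eq_zero_or_pos χ with rfl | hχ
  · exact ⟨X, 1, one_ne_zero, by simp, by simp, by simp⟩
  have hd : 0 < ‖X.val.det‖ := norm_pos_iff.2 (Matrix.isUnit_iff_isUnit_det _ |>.1 X.isUnit).ne_zero
  set s : ℝ := ‖X.val.det‖ ^ (-(χ : ℝ)⁻¹) with hs
  have hs0 : 0 < s := Real.rpow_pos_of_pos hd _
  have hsc : (s : ℂ) ≠ 0 := by exact_mod_cast hs0.ne'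
  refine ⟨⟨(s : ℂ) • X.val, (s : ℂ)⁻¹ • (X⁻¹).val, ?_, ?_⟩, s, hsc, rfl, rfl, ?_⟩
  · rw [smul_mul_smul_comm, mul_inv_cancel₀ hsc]; simp
  · rw [smul_mul_smul_comm, inv_mul_cancel₀ hsc]; simp
  · change ‖((s : ℂ) • X.val).det‖ = 1
    rw [Matrix.det_smul, norm_mul, norm_pow, Complex.norm_real, Real.norm_of_nonneg hs0.le,
      Fintype.card_fin, hs, ← Real.rpow_natCast, ← Real.rpow_mul hd.le, neg_mul,
      inv_mul_cancel₀ (by exact_mod_cast hχ.ne'), Real.rpow_neg_one, inv_mul_cancel₀ hd.ne']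

theorem SpansMatrices.rectAction [DecidableEq α] {u : G × K → Matrix α α ℂ}
    (hu : ∀ p q, u (p * q) = u p * u q) (h1 : u 1 = 1) {A : LocalTensor α χ}
    (hA : SpansMatrices (flatTensor A)) (x : DoubledSymmetry G K) :
    SpansMatrices (flatTensor (MixedSPT.rectAction u x A)) := by
  refine (hA.twistLegs x.right).lin ?_
  have hinv : ∀ p, u p * u p⁻¹ = 1 := fun p => by rw [← hu, mul_inv_cancel, h1]
  refine IsUnit.of_mul_eq_one
    (sandwich (u (x.left.1, x.left.2.2)⁻¹) (u (x.left.2.1, x.left.2.2)⁻¹)) ?_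
  rw [symSuper, sandwich_mul, hinv, hinv]
  ext p q
  simp only [sandwich, Matrix.of_apply, Matrix.one_apply, Prod.ext_iff]
  split_ifs <;> simp_all

/-- If a group action maps an injective tensor to tensors generating the same operators up to phases,
then it is implemented by a projective representation on the virtual space. -/
theorem exists_hasTensorClass [DecidableEq α] {u : G × K → Matrix α α ℂ}
    (hu : ∀ p q, u (p * q) = u p * u q) (h1 : u 1 = 1) {A : LocalTensor α χ} (hχ : 0 < χ)
    (hA : SpansMatrices (flatTensor A))
    (hz : ∀ (x : DoubledSymmetry G K) (n : ℕ), 0 < n →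
      ∃ z : ℂ, ‖z‖ = 1 ∧ mpdo A n = z • mpdo (rectAction u x A) n) :
    ∃ c : SPTClass G K, HasTensorClass u A c := by
  have : Nonempty (Fin χ) := ⟨⟨0, hχ⟩⟩
  have hne : ∃ p q, (flatTensor A p * flatTensor A q).trace ≠ 0 := by
    by_contra! h
    have h0 : ∀ p, flatTensor A p = 0 := fun p => hA.eq_zero (h p)
    exact one_ne_zero (hA.eq_zero (Z := 1) fun p => by rw [h0]; simp)
  have key : ∀ x : DoubledSymmetry G K, ∃ (X : GL (Fin χ) ℂ) (t : Circle), ‖X.val.det‖ = 1 ∧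
      ∀ i j, rectAction u x A i j = (t : ℂ) • ((X⁻¹).val * A i j * X.val) := by
    intro x
    obtain ⟨z₂, hz₂, e₂⟩ := hz x 2 two_pos
    obtain ⟨z₃, hz₃, e₃⟩ := hz x 3 three_pos
    have n₂ : z₂ ≠ 0 := norm_ne_zero_iff.1 (by rw [hz₂]; exact one_ne_zero)
    have n₃ : z₃ ≠ 0 := norm_ne_zero_iff.1 (by rw [hz₃]; exact one_ne_zero)
    have f₂ : ∀ p q, (flatTensor A p * flatTensor A q).trace = z₂ *
        (flatTensor (rectAction u x A) p * flatTensor (rectAction u x A) q).trace := by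
      intro p q
      rw [← mpdo_two, ← mpdo_two, e₂]
      rfl
    have f₃ : ∀ p q r, (flatTensor A p * flatTensor A q * flatTensor A r).trace = z₃ *
        (flatTensor (rectAction u x A) p * flatTensor (rectAction u x A) q *
          flatTensor (rectAction u x A) r).trace := by
      intro p q r
      rw [← mpdo_three, ← mpdo_three, e₃]
      rfl
    obtain ⟨X, t, ht, hX⟩ := hA.exists_conj (hA.rectAction hu h1 x) n₂ n₃ f₂ f₃
    have htn : ‖t‖ = 1 := by
      obtain ⟨p, q, hpq⟩ := hne
      have := f₂ p q
      rw [hX, hX, smul_mul_smul_comm, Matrix.trace_smul] at this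
      have hc : (X⁻¹).val * flatTensor A p * X.val * ((X⁻¹).val * flatTensor A q * X.val) =
          (X⁻¹).val * (flatTensor A p * flatTensor A q) * X.val := by simp [mul_assoc]
      have hc' : ((X⁻¹).val * (flatTensor A p * flatTensor A q) * X.val).trace =
          (flatTensor A p * flatTensor A q).trace := by
        rw [Matrix.trace_mul_comm, ← mul_assoc, Units.mul_inv, one_mul]
      rw [hc, hc', smul_eq_mul] at this
      have h2 := congrArg norm this
      rw [norm_mul, norm_mul, norm_mul, hz₂, one_mul] at h2
      have h3 : ‖t‖ * ‖t‖ = 1 := by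
        apply mul_right_cancel₀ (norm_ne_zero_iff.2 hpq)
        rw [one_mul]; exact h2.symm
      nlinarith [norm_nonneg t]
    obtain ⟨Y, r, hr, hY, hY', hdet⟩ := exists_rescale X
    refine ⟨Y, ⟨t, mem_sphere_zero_iff_norm.2 htn⟩, hdet, fun i j => ?_⟩
    rw [hY, hY', show rectAction u x A i j = _ from hX (i, j)]
    rw [Matrix.mul_smul, Matrix.smul_mul, Matrix.smul_mul, smul_smul r, mul_inv_cancel₀ hr, one_smul]
    rfl
  choose V θ hdet hV using key
  have hω : ∀ x y, ∃ w : Circle,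
      (V x).val * twist x.right (V y).val = (w : ℂ) • (V (x * y)).val := by
    intro x y
    let Vy := twistGL x.right (V y)
    have hVy : Vy.val = twist x.right (V y).val := rfl
    have hVy' : (Vy⁻¹).val = twist x.right ((V y)⁻¹).val := rfl
    have e : ∀ p : α × α, twistScalar x.right (θ y) • ((Vy⁻¹).val * ((θ x : ℂ) •
        (((V x)⁻¹).val * flatTensor A p * (V x).val)) * Vy.val) =
        (θ (x * y) : ℂ) • (((V (x * y))⁻¹).val * flatTensor A p * (V (x * y)).val) := by
      intro p
      have hAf : rectAction u y A = fun i j => (θ y : ℂ) • (((V y)⁻¹).val * A i j * (V y).val) := by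
        funext i j; exact hV y i j
      rw [flatTensor, ← hV, ← hV, ← rectAction_rectAction hu, hAf,
        rectAction_smul u x (θ y) (fun i j => ((V y)⁻¹).val * A i j * (V y).val), rectAction_mul_mul]
      rfl
    let Z : GL (Fin χ) ℂ := V x * Vy * (V (x * y))⁻¹
    obtain ⟨b, hb, hZ⟩ := hA.exists_scalar hχ (Z := Z.val) (Units.isUnit Z)
      (s := (twistScalar x.right (θ y) * θ x)⁻¹ * θ (x * y)) (fun p => by
        have h0 : twistScalar x.right (θ y) * (θ x : ℂ) ≠ 0 :=
          mul_ne_zero (twistScalar_ne_zero (Circle.coe_ne_zero _)) (Circle.coe_ne_zero _)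
        have e1 := e p
        simp only [Matrix.mul_smul, Matrix.smul_mul, smul_smul] at e1
        have e2 := congrArg (fun M => (V x).val * (Vy.val * M * ((V (x * y))⁻¹).val)) e1
        simp only [Matrix.mul_smul, Matrix.smul_mul] at e2
        have c1 : (V x).val * (Vy.val * ((Vy⁻¹).val * (((V x)⁻¹).val * flatTensor A p *
            (V x).val) * Vy.val) * ((V (x * y))⁻¹).val) = flatTensor A p * Z.val := by
          simp [Z, mul_assoc]
        have c2 : (V x).val * (Vy.val * (((V (x * y))⁻¹).val * flatTensor A p *
            (V (x * y)).val) * ((V (x * y))⁻¹).val) = Z.val * flatTensor A p := by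
          simp [Z, mul_assoc]
        rw [c1, c2] at e2
        rw [mul_smul, ← e2, smul_smul, inv_mul_cancel₀ h0, one_smul])
    have hmul : (V x).val * twist x.right (V y).val = b • (V (x * y)).val := by
      have := congrArg (fun M => M * (V (x * y)).val) hZ
      simpa [Z, mul_assoc, hVy] using this
    -- comparing determinants shows that the scalar is a phase
    have hbn : ‖b‖ = 1 := by
      have h := congrArg (fun M => ‖M.det‖) hmul
      simp only [Matrix.det_mul, Matrix.det_smul, norm_mul, norm_pow, norm_det_twist, hdet,
        Fintype.card_fin, mul_one] at h
      exact (pow_eq_one_iff_of_nonneg (norm_nonneg b) hχ.ne').1 h.symm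
    exact ⟨⟨b, mem_sphere_zero_iff_norm.2 hbn⟩, hmul⟩
  choose ω hω using hω
  have hproj : IsProjSymmetry u A V θ (fun p => ω p.1 p.2) := ⟨hV, hω⟩
  exact ⟨_, hasTensorClass_iff.2 ⟨V, θ, _, hproj, isMulCocycle₂_of_mul hχ hω, rfl⟩⟩

theorem mpdo_twistLegs {α : Type*} {χ : ℕ} (s : Multiplicative (ZMod 2)) (A : LocalTensor α χ) (n : ℕ)
    (h : (mpdo A n).IsHermitian) : mpdo (twistLegs s A) n = mpdo A n := by
  ext σ τ
  rw [mpdo_apply, blk_twistLegs]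
  rcases zmodTwo_cases s with rfl | rfl
  · simp [twistLegs, mpdo_apply]
  · rw [← h.apply, mpdo_apply]
    simp [twistLegs, twist_nontrivial, Matrix.trace]

/-- The action of the doubled symmetry on the operators generated by a tensor. -/
theorem mpdo_rectAction (u : G × K → Matrix α α ℂ) (x : DoubledSymmetry G K)
    (A : LocalTensor α χ) (n : ℕ) (h : (mpdo A n).IsHermitian) :
    mpdo (rectAction u x A) n = tensorPow n (u (x.left.1, x.left.2.2)) * mpdo A n *
      (tensorPow n (u (x.left.2.1, x.left.2.2)))ᴴ := by
  rw [rectAction, mpdo_lin, superLayer, symSuper, spow_sandwich, superMap_sandwich,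
    mpdo_twistLegs _ _ _ h]

theorem IsSymmetricState.mul_mul {u : G × K → Matrix α α ℂ}
    (hu : ∀ p q, u (p * q) = u p * u q) {ρ : ChainState α}
    (h : IsSymmetricState u ρ) (g g' : G) (k : K) {n : ℕ} (hn : 0 < n) :
    ∃ z : ℂ, ‖z‖ = 1 ∧ tensorPow n (u (g, k)) * ρ n * (tensorPow n (u (g', k)))ᴴ = z • ρ n := by
  obtain ⟨hG, hK⟩ := h n hn
  obtain ⟨z, hz, -⟩ := hG g
  obtain ⟨z', -, hz'⟩ := hG g'
  refine ⟨conj (z' : ℂ) * z, ?_, ?_⟩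
  · rw [norm_mul, RCLike.norm_conj, Circle.norm_coe, Circle.norm_coe, one_mul]
  have e : ∀ g : G, tensorPow n (u (g, k)) = tensorPow n (u (g, 1)) * tensorPow n (u (1, k)) := by
    intro g
    rw [← tensorPow_mul, ← hu]
    simp
  rw [e g, e g', Matrix.conjTranspose_mul]
  calc _ = tensorPow n (u (g, 1)) * (tensorPow n (u (1, k)) * ρ n * (tensorPow n (u (1, k)))ᴴ) *
        (tensorPow n (u (g', 1)))ᴴ := by simp only [Matrix.mul_assoc]
    _ = _ := by rw [hK, hz, Matrix.smul_mul, hz', smul_smul, mul_comm]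

theorem IsStrongInjective.exists_generatedInClass [DecidableEq α] {u : G × K → Matrix α α ℂ}
    (hu : ∀ p q, u (p * q) = u p * u q) (h1 : u 1 = 1) {A : LocalTensor α χ}
    (hA : IsStrongInjective A) (hsym : IsSymmetricState u (mpdo A)) :
    ∃ c : SPTClass G K, GeneratedInClass u (mpdo A) c := by
  obtain ⟨c, hc⟩ := exists_hasTensorClass hu h1 hA.dim_pos hA.spans fun x n hn => by
    obtain ⟨z, hz, e⟩ := hsym.mul_mul hu x.left.1 x.left.2.1 x.left.2.2 hn
    have hz0 : z ≠ 0 := norm_ne_zero_iff.1 (by rw [hz]; exact one_ne_zero)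
    refine ⟨z⁻¹, by rw [norm_inv, hz, inv_one], ?_⟩
    rw [mpdo_rectAction u x A n (hA.posSemidef n hn).isHermitian, e, smul_smul,
      inv_mul_cancel₀ hz0, one_smul]
  exact ⟨c, χ, A, hA, fun n _ => ⟨1, one_pos, by simp⟩, hc⟩

end exist

/-! ### Symmetric non-degenerate channels preserve the class -/

section channel

variable {G K : Type} [Group G] [Group K] {β : Type*} [Fintype β] [DecidableEq β]

/-- The superoperator `S` is a symmetric non-degenerate channel: it is completely positive, invertible
and trace preserving, and it commutes up to phases with the action of the doubled symmetry on the
physical legs. -/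
structure IsSymmetricChannel (u : G × K → Matrix β β ℂ) (S : Matrix (β × β) (β × β) ℂ) : Prop where
  kraus : ∃ (κ : Type) (_ : Fintype κ) (L : κ → Matrix β β ℂ), S = ∑ a, sandwich (L a) (L a)
  isUnit : IsUnit S
  trace_preserving : ∀ i' j', ∑ i, S (i, i) (i', j') = if i' = j' then 1 else 0
  comm : ∀ x : DoubledSymmetry G K,
    ∃ z : ℂ, ‖z‖ = 1 ∧ S * symSuper u x = z • (symSuper u x * S)

theorem isUnit_spow {S : Matrix (β × β) (β × β) ℂ} (h : IsUnit S) (m : ℕ) : IsUnit (spow m S) := by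
  obtain ⟨T, hT⟩ := h.exists_right_inv
  exact IsUnit.of_mul_eq_one (spow m T) (by rw [← spow_mul, hT, spow_one])

theorem IsSymmetricChannel.spow {u : G × K → Matrix β β ℂ} {S : Matrix (β × β) (β × β) ℂ}
    (h : IsSymmetricChannel u S) (m : ℕ) :
    IsSymmetricChannel (fun p => tensorPow m (u p)) (spow m S) where
  kraus := by
    obtain ⟨κ, _, L, rfl⟩ := h.kraus
    refine ⟨Fin m → κ, inferInstance, fun a => Matrix.of fun σ τ => ∏ x, L (a x) (σ x) (τ x), ?_⟩
    rw [spow_sum]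
    refine Finset.sum_congr rfl fun a _ => ?_
    ext p q
    simp [sandwich, Finset.prod_mul_distrib]
  isUnit := isUnit_spow h.isUnit m
  trace_preserving σ' τ' := by
    simp only [MixedSPT.spow, Matrix.of_apply]
    have := Finset.prod_univ_sum (fun _ : Fin m => (Finset.univ : Finset β))
      (fun x i => S (i, i) (σ' x, τ' x))
    rw [Fintype.piFinset_univ] at this
    rw [← this]
    simp only [h.trace_preserving]
    by_cases e : σ' = τ'
    · simp [e]
    · rw [if_neg e]
      obtain ⟨x, hx⟩ := Function.ne_iff.1 e
      exact Finset.prod_eq_zero (Finset.mem_univ x) (if_neg hx)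
  comm x := by
    obtain ⟨z, hz, e⟩ := h.comm x
    refine ⟨z ^ m, by rw [norm_pow, hz, one_pow], ?_⟩
    rw [← spow_symSuper, ← spow_mul, e, spow_smul, spow_mul]

theorem IsSymmetricChannel.posSemidef {u : G × K → Matrix β β ℂ} {S : Matrix (β × β) (β × β) ℂ}
    (h : IsSymmetricChannel u S) {X : Matrix β β ℂ} (hX : X.PosSemidef) :
    (superMap S X).PosSemidef := by
  obtain ⟨κ, _, L, rfl⟩ := h.kraus
  rw [superMap_sum]
  simp only [superMap_sandwich]
  exact Matrix.posSemidef_sum _ fun a _ => hX.mul_mul_conjTranspose_same (L a)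

theorem IsSymmetricChannel.twistSuper {u : G × K → Matrix β β ℂ} {S : Matrix (β × β) (β × β) ℂ}
    (h : IsSymmetricChannel u S) (s : Multiplicative (ZMod 2)) : twistSuper s S = S := by
  obtain ⟨κ, _, L, rfl⟩ := h.kraus
  unfold MixedSPT.twistSuper
  split_ifs
  · rfl
  · ext p q
    simp [Matrix.sum_apply, sandwich, mul_comm]

theorem IsSymmetricChannel.transfer_lin {u : G × K → Matrix β β ℂ}
    {S : Matrix (β × β) (β × β) ℂ} (h : IsSymmetricChannel u S) {χ : ℕ} (A : LocalTensor β χ) :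
    transfer (lin S A) = transfer A := by
  simp only [transfer, lin]
  rw [Finset.sum_comm]
  refine Finset.sum_congr rfl fun i' _ => ?_
  rw [Finset.sum_comm]
  simp_rw [← Finset.sum_smul, h.trace_preserving]
  simp

theorem IsProjSymmetry.lin {u : G × K → Matrix β β ℂ} {S : Matrix (β × β) (β × β) ℂ}
    (h : IsSymmetricChannel u S) {χ : ℕ} {A : LocalTensor β χ}
    {V : DoubledSymmetry G K → GL (Fin χ) ℂ} {θ : DoubledSymmetry G K → Circle}
    {ω : DoubledSymmetry G K × DoubledSymmetry G K → Circle} (hA : IsProjSymmetry u A V θ ω) :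
    ∃ θ', IsProjSymmetry u (lin S A) V θ' ω := by
  choose z hz e using h.comm
  have hz0 : ∀ x, z x ≠ 0 := fun x => norm_ne_zero_iff.1 (by rw [hz]; exact one_ne_zero)
  let z' : DoubledSymmetry G K → Circle := fun x =>
    ⟨(z x)⁻¹, mem_sphere_zero_iff_norm.2 (by rw [norm_inv, hz, inv_one])⟩
  refine ⟨fun x => z' x * θ x, fun x i j => ?_, hA.mul⟩
  have e' : symSuper u x * S = (z x)⁻¹ • (S * symSuper u x) := by
    rw [e, smul_smul, inv_mul_cancel₀ (hz0 x), one_smul]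
  have hAx : rectAction u x A = fun i j => (θ x : ℂ) • (((V x)⁻¹).val * A i j * (V x).val) := by
    funext i j; exact hA.act x i j
  rw [rectAction, twistLegs_lin, h.twistSuper, lin_lin, e', smul_lin, ← lin_lin]
  change (z x)⁻¹ • MixedSPT.lin S (rectAction u x A) i j = _
  rw [hAx, lin_smul (θ x : ℂ) S (fun i j => ((V x)⁻¹).val * A i j * (V x).val), smul_smul]
  change _ = (((z' x : Circle) : ℂ) * (θ x : ℂ)) • _
  congr 1
  exact (map_lin ((LinearMap.mulRight ℂ (V x).val) ∘ₗ (LinearMap.mulLeft ℂ ((V x)⁻¹).val)) S A i j).symm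

/-- A symmetric non-degenerate channel on every site preserves the class. -/
theorem GeneratedInClass.superLayer {u : G × K → Matrix β β ℂ} {S : Matrix (β × β) (β × β) ℂ}
    (hS : IsSymmetricChannel u S) {ρ : ChainState β} {c : SPTClass G K}
    (h : GeneratedInClass u ρ c) : GeneratedInClass u (superLayer S ρ) c := by
  obtain ⟨χ, B, hB, hρ, hc⟩ := h
  refine ⟨χ, lin S B, ⟨fun n hn => ?_, ?_, ?_⟩, fun n hn => ?_, ?_⟩
  · rw [mpdo_lin]
    exact (hS.spow n).posSemidef (hB.posSemidef n hn)
  · exact (injective_tensorMap_iff _).2 (hB.spans.lin hS.isUnit)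
  · rw [hS.transfer_lin]
    exact hB.transfer_gap
  · obtain ⟨s, hs, e⟩ := hρ n hn
    exact ⟨s, hs, by rw [mpdo_lin]; exact superLayer_smul S e⟩
  · rw [hasTensorClass_iff] at hc ⊢
    obtain ⟨V, θ, ω, h1, h2⟩ := hc
    obtain ⟨θ', h'⟩ := h1.lin hS
    exact ⟨V, θ', ω, h', h2⟩

theorem HasSPTClass.superLayer {u : G × K → Matrix β β ℂ} {S : Matrix (β × β) (β × β) ℂ}
    (hS : IsSymmetricChannel u S) {ρ : ChainState β} {c : SPTClass G K}
    (h : HasSPTClass u ρ c) : HasSPTClass u (superLayer S ρ) c := by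
  obtain ⟨m, hm, h⟩ := hasSPTClass_iff.1 h
  refine hasSPTClass_iff.2 ⟨m, hm, ?_⟩
  rw [group_superLayer]
  exact h.superLayer (hS.spow m)

/-- The superoperator of a quantum channel. -/
def Channel.superop (N : Channel β) : Matrix (β × β) (β × β) ℂ :=
  ∑ a, sandwich (N.kraus a) (N.kraus a)

theorem Channel.map_eq (N : Channel β) (X : Matrix β β ℂ) :
    N.map X = superMap N.superop X := by
  simp only [Channel.map, Channel.superop, superMap_sum, superMap_sandwich]

theorem superMap_injective {α : Type*} [Fintype α] [DecidableEq α]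
    {S S' : Matrix (α × α) (α × α) ℂ} (h : ∀ X, superMap S X = superMap S' X) : S = S' := by
  ext p q
  have := congrFun (congrFun (h (Matrix.single q.1 q.2 1)) p.1) p.2
  simpa [superMap_apply, Matrix.single, ite_and] using this

theorem applyLayer_false {α : Type*} [Fintype α] [DecidableEq α] (N : Channel (Fin 2 → α))
    (ρ : ChainState (Fin 2 → α)) : applyLayer false N ρ = superLayer N.superop ρ := by
  funext n
  simp only [applyLayer, superLayer, Channel.superop, spow_sum, superMap_sum]
  refine Finset.sum_congr rfl fun a _ => ?_
  rw [← superMap_sandwich]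
  congr 1
  ext p q
  simp [sandwich, Finset.prod_mul_distrib, pairOf]

theorem sandwich_smul {β : Type*} (c d : ℂ) (a b : Matrix β β ℂ) :
    sandwich (c • a) (d • b) = (c * conj d) • sandwich a b := by
  ext p q
  simp only [sandwich, Matrix.of_apply, Matrix.smul_apply, smul_eq_mul, map_mul]
  ring

theorem Channel.IsSymmetric.isSymmetricChannel {v : G × K → Matrix β β ℂ}
    (hv : ∀ p q, v (p * q) = v p * v q) (hvu : ∀ p, (v p)ᴴ * v p = 1)
    {N : Channel β} (h : N.IsSymmetric v) (hN : N.IsNondegenerate) :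
    IsSymmetricChannel v N.superop where
  kraus := ⟨_, _, _, rfl⟩
  isUnit := by
    rw [← Matrix.mulVec_injective_iff_isUnit]
    have e : ∀ f : β × β → ℂ, ∀ i j,
        N.superop.mulVec f (i, j) = N.map (Matrix.of fun i j => f (i, j)) i j := by
      intro f i j
      rw [Channel.map_eq, superMap_apply, ← Fintype.sum_prod_type']
      rfl
    intro f f' hf
    have : (Matrix.of fun i j => f (i, j)) = Matrix.of fun i j => f' (i, j) := by
      apply hN
      ext i j
      rw [← e, ← e, hf]
    funext p
    exact congrFun (congrFun this p.1) p.2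
  trace_preserving i' j' := by
    have := congrFun (congrFun N.trace_preserving j') i'
    rw [Matrix.one_apply] at this
    simp only [eq_comm (a := i'), ← this, Channel.superop, Matrix.sum_apply, sandwich,
      Matrix.of_apply, Matrix.mul_apply, Matrix.conjTranspose_apply]
    rw [Finset.sum_comm]
    exact Finset.sum_congr rfl fun _ _ => Finset.sum_congr rfl fun _ _ => mul_comm _ _
  comm x := by
    have hs : ∀ g : G, ∃ z : Circle, ∀ a, N.kraus a * v (g, 1) =
        (z : ℂ) • (v (g, 1) * N.kraus a) := by
      intro g
      obtain ⟨z, hz⟩ := h.1 g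
      refine ⟨z⁻¹, fun a => ?_⟩
      have e := congrArg (fun M => M * v (g, 1)) (hz a)
      simp only [mul_assoc, hvu, mul_one, Matrix.smul_mul] at e
      rw [e, smul_smul, ← Circle.coe_mul, inv_mul_cancel, Circle.coe_one, one_smul]
    obtain ⟨z, hz⟩ := hs x.left.1
    obtain ⟨z', hz'⟩ := hs x.left.2.1
    set k := x.left.2.2
    have hk : sandwich (v (1, k)) (v (1, k)) * N.superop * sandwich (v (1, k))ᴴ (v (1, k))ᴴ =
        N.superop := by
      apply superMap_injective
      intro X
      rw [superMap_mul, superMap_mul, ← Channel.map_eq, ← Channel.map_eq, superMap_sandwich,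
        superMap_sandwich, Matrix.conjTranspose_conjTranspose, h.2]
    have hk' : N.superop * sandwich (v (1, k)) (v (1, k)) =
        sandwich (v (1, k)) (v (1, k)) * N.superop := by
      have e := congrArg (fun M => M * sandwich (v (1, k)) (v (1, k))) hk
      have e1 : sandwich (1 : Matrix β β ℂ) 1 = 1 := by
        ext p q
        simp only [sandwich, Matrix.of_apply, Matrix.one_apply, Prod.ext_iff]
        split_ifs <;> simp_all
      simp only [mul_assoc, sandwich_mul, hvu, e1, mul_one] at e
      exact e.symm
    have hsym : symSuper v x = sandwich (v (x.left.1, 1)) (v (x.left.2.1, 1)) *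
        sandwich (v (1, k)) (v (1, k)) := by
      rw [sandwich_mul, ← hv, ← hv, symSuper]
      simp [k]
    have hg : N.superop * sandwich (v (x.left.1, 1)) (v (x.left.2.1, 1)) =
        ((z : ℂ) * conj (z' : ℂ)) •
          (sandwich (v (x.left.1, 1)) (v (x.left.2.1, 1)) * N.superop) := by
      simp only [Channel.superop, Finset.sum_mul, Finset.mul_sum, sandwich_mul, hz, hz',
        sandwich_smul, Finset.smul_sum]
    refine ⟨(z : ℂ) * conj (z' : ℂ), ?_, ?_⟩
    · rw [norm_mul, RCLike.norm_conj, Circle.norm_coe, Circle.norm_coe, one_mul]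
    · rw [hsym, ← mul_assoc, hg, Matrix.smul_mul, mul_assoc, hk', mul_assoc]

end channel

/-! ### Moving the boundaries of the blocks -/

/-- Moving a factor around the trace of a periodic product. -/
theorem trace_prod_ofFn_rotate {χ D : ℕ} : ∀ {n : ℕ}, 0 < n →
    ∀ (y : Fin n → Matrix (Fin D) (Fin χ) ℂ) (x : Fin n → Matrix (Fin χ) (Fin D) ℂ),
    (List.ofFn fun i => y i * x i).prod.trace =
      (List.ofFn fun i => x i * y (finRotate n i)).prod.trace
  | n + 1, _, y, x => by
    have key : ∀ (n : ℕ) (y : Fin (n + 1) → Matrix (Fin D) (Fin χ) ℂ)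
        (x : Fin (n + 1) → Matrix (Fin χ) (Fin D) ℂ),
        x 0 * (List.ofFn fun i : Fin n => y i.succ * x i.succ).prod =
          (List.ofFn fun i : Fin n => x i.castSucc * y i.succ).prod * x (Fin.last n) := by
      intro n
      induction n with
      | zero => intro y x; simp
      | succ n ih =>
        intro y x
        have := ih (fun i => y i.succ) (fun i => x i.succ)
        rw [List.ofFn_succ, List.prod_cons, List.ofFn_succ, List.prod_cons]
        simp only [Fin.succ_zero_eq_one, Fin.succ_last, ← Fin.castSucc_succ] at this ⊢
        rw [Matrix.mul_assoc (y 1), this, Matrix.mul_assoc (x _ * _), ← this]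
        simp only [Fin.castSucc_zero, Matrix.mul_assoc]
    rw [List.ofFn_succ, List.prod_cons, Matrix.mul_assoc, key, ← Matrix.mul_assoc,
      Matrix.trace_mul_comm, List.ofFn_succ_last, List.prod_append, List.prod_singleton,
      finRotate_last]
    simp only [finRotate_apply, Fin.coeSucc_eq_succ]
    rw [Matrix.trace_mul_comm, Matrix.mul_assoc, Matrix.trace_mul_comm, Matrix.mul_assoc]

theorem mpdo_rotate {α : Type*} {χ : ℕ} (A : LocalTensor α χ) (n : ℕ) (σ τ : Fin n → α) :
    mpdo A n (fun x => σ (finRotate n x)) (fun x => τ (finRotate n x)) = mpdo A n σ τ := by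
  rcases Nat.eq_zero_or_pos n with rfl | hn
  · rfl
  · have := trace_prod_ofFn_rotate hn (fun x => A (σ x) (τ x)) fun _ => 1
    simp only [mul_one, one_mul] at this
    exact this.symm

section split

variable {P Q R : Type*} [Fintype P] [Fintype Q] [Fintype R] {χ D : ℕ}

/-- The tensor of a site composed of two parts, cut along a virtual space of minimal dimension. -/
theorem exists_minimal_factorization {R : Type*} (B : LocalTensor R χ) (e : P × Q ≃ R) :
    ∃ (D : ℕ) (X : P → P → Matrix (Fin χ) (Fin D) ℂ) (Y : Q → Q → Matrix (Fin D) (Fin χ) ℂ)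
      (L : P → P → Matrix (Fin D) (Fin χ) ℂ) (S : Q → Q → Matrix (Fin χ) (Fin D) ℂ),
      (∀ p q p' q', B (e (p, q)) (e (p', q')) = X p p' * Y q q') ∧
      ∑ p, ∑ p', L p p' * X p p' = 1 ∧ ∑ q, ∑ q', Y q q' * S q q' = 1 := by
  classical
  obtain ⟨D, X, Y, L, S, h, hL, hS⟩ := exists_rank_factorization
    (Matrix.of fun (i : Fin χ × P × P) (j : Q × Q × Fin χ) =>
      B (e (i.2.1, j.1)) (e (i.2.2, j.2.1)) i.1 j.2.2)
  refine ⟨D, fun p p' => Matrix.of fun a d => X (a, p, p') d,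
    fun q q' => Matrix.of fun d b => Y d (q, q', b), fun p p' => Matrix.of fun d a => L d (a, p, p'),
    fun q q' => Matrix.of fun b d => S (q, q', b) d, ?_, ?_, ?_⟩
  · intro p q p' q'
    ext a b
    exact congrFun (congrFun h (a, p, p')) (q, q', b)
  · ext d d'
    rw [← congrFun (congrFun hL d) d', Matrix.mul_apply]
    simp only [Matrix.sum_apply, Matrix.mul_apply, Matrix.of_apply, Fintype.sum_prod_type]
    rw [Finset.sum_comm]
    simp only [Finset.sum_comm (s := (Finset.univ : Finset (Fin χ)))]
    rw [Finset.sum_comm]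
  · ext d d'
    rw [← congrFun (congrFun hS d) d', Matrix.mul_apply]
    simp only [Matrix.sum_apply, Matrix.mul_apply, Matrix.of_apply, Fintype.sum_prod_type]

variable {G K : Type} [Group G] [Group K]

theorem rectAction_split {χ₁ χ₂ χ₃ : ℕ} {e : P × Q ≃ R} {u : G × K → Matrix R R ℂ}
    {uP : G × K → Matrix P P ℂ} {uQ : G × K → Matrix Q Q ℂ}
    (hu : ∀ g p q p' q', u g (e (p, q)) (e (p', q')) = uP g p p' * uQ g q q')
    {B : R → R → Matrix (Fin χ₁) (Fin χ₃) ℂ} {X : P → P → Matrix (Fin χ₁) (Fin χ₂) ℂ}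
    {Y : Q → Q → Matrix (Fin χ₂) (Fin χ₃) ℂ}
    (hB : ∀ p q p' q', B (e (p, q)) (e (p', q')) = X p p' * Y q q')
    (x : DoubledSymmetry G K) (p : P) (q : Q) (p' : P) (q' : Q) :
    rectAction u x B (e (p, q)) (e (p', q')) = rectAction uP x X p p' * rectAction uQ x Y q q' := by
  have hs : ∀ a b a' b', symSuper u x (e (p, q), e (p', q')) (e (a, b), e (a', b')) =
      symSuper uP x (p, p') (a, a') * symSuper uQ x (q, q') (b, b') := by
    intro a b a' b'
    simp only [symSuper, sandwich, Matrix.of_apply, hu, map_mul]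
    ring
  have ht : ∀ a b a' b', twistLegs x.right B (e (a, b)) (e (a', b')) =
      twistLegs x.right X a a' * twistLegs x.right Y b b' := by
    intro a b a' b'
    simp only [twistLegs, hB]
    split_ifs <;> rw [twist_mul]
  simp only [rectAction, lin, ← e.sum_comp, Fintype.sum_prod_type, hs, ht]
  rw [Matrix.sum_mul]
  refine Finset.sum_congr rfl fun a _ => ?_
  rw [Matrix.sum_mul, Finset.sum_comm]
  refine Finset.sum_congr rfl fun a' _ => ?_
  rw [Matrix.mul_sum]
  refine Finset.sum_congr rfl fun b _ => ?_
  rw [Matrix.mul_sum]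
  refine Finset.sum_congr rfl fun b' _ => ?_
  rw [Matrix.smul_mul, Matrix.mul_smul, smul_smul]

/-- A projective symmetry of a tensor `X Y` acts on the virtual space between the two factors of a
minimal factorization, with the same factor system. -/
theorem exists_virtual_symmetry {uP : G × K → Matrix P P ℂ} {uQ : G × K → Matrix Q Q ℂ}
    (huP : ∀ g h, uP (g * h) = uP g * uP h)
    {X : P → P → Matrix (Fin χ) (Fin D) ℂ} {Y : Q → Q → Matrix (Fin D) (Fin χ) ℂ}
    {L : P → P → Matrix (Fin D) (Fin χ) ℂ} {S : Q → Q → Matrix (Fin χ) (Fin D) ℂ}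
    (hL : ∑ p, ∑ p', L p p' * X p p' = 1) (hS : ∑ q, ∑ q', Y q q' * S q q' = 1)
    {V : DoubledSymmetry G K → GL (Fin χ) ℂ} {θ : DoubledSymmetry G K → Circle}
    {ω : DoubledSymmetry G K × DoubledSymmetry G K → Circle}
    (hact : ∀ x p q p' q', rectAction uP x X p p' * rectAction uQ x Y q q' =
      (θ x : ℂ) • (((V x)⁻¹).val * (X p p' * Y q q') * (V x).val))
    (hmul : ∀ x y, (V x).val * twist x.right (V y).val = (ω (x, y) : ℂ) • (V (x * y)).val) :
    ∃ W : DoubledSymmetry G K → GL (Fin D) ℂ,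
      (∀ x p p', rectAction uP x X p p' = ((V x)⁻¹).val * X p p' * (W x).val) ∧
      (∀ x q q', rectAction uQ x Y q q' =
        (θ x : ℂ) • (((W x)⁻¹).val * Y q q' * (V x).val)) ∧
      ∀ x y, (W x).val * twist x.right (W y).val = (ω (x, y) : ℂ) • (W (x * y)).val := by
  have hW : ∀ x, ∃ W : GL (Fin D) ℂ,
      (∀ p p', rectAction uP x X p p' = ((V x)⁻¹).val * X p p' * W.val) ∧
      (∀ q q', rectAction uQ x Y q q' = (θ x : ℂ) • ((W⁻¹).val * Y q q' * (V x).val)) := by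
    intro x
    have hθ : (θ x : ℂ) ≠ 0 := Circle.coe_ne_zero _
    set aX := rectAction uP x X
    set aY := rectAction uQ x Y
    let W₀ : Matrix (Fin D) (Fin D) ℂ := ∑ p, ∑ p', L p p' * ((V x).val * aX p p')
    let W₁ : Matrix (Fin D) (Fin D) ℂ := ∑ q, ∑ q', aY q q' * (((V x)⁻¹).val * S q q')
    have h₀ : ∀ q q', W₀ * aY q q' = (θ x : ℂ) • (Y q q' * (V x).val) := by
      intro q q'
      have e : ∀ p p', L p p' * ((V x).val * aX p p') * aY q q' =
          (θ x : ℂ) • ((L p p' * X p p') * (Y q q' * (V x).val)) := by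
        intro p p'
        rw [Matrix.mul_assoc, Matrix.mul_assoc, hact, Matrix.mul_smul, Matrix.mul_smul]
        congr 1
        rw [← Matrix.mul_assoc (V x).val, ← Matrix.mul_assoc (V x).val, Units.mul_inv,
          Matrix.one_mul]
        simp only [Matrix.mul_assoc]
      simp only [W₀, Matrix.sum_mul, e, ← Finset.smul_sum]
      simp only [← Matrix.sum_mul, hL, Matrix.one_mul]
    have h₁ : ∀ p p', aX p p' * W₁ = (θ x : ℂ) • (((V x)⁻¹).val * X p p') := by
      intro p p'
      have e : ∀ q q', aX p p' * (aY q q' * (((V x)⁻¹).val * S q q')) =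
          (θ x : ℂ) • ((((V x)⁻¹).val * X p p') * (Y q q' * S q q')) := by
        intro q q'
        rw [← Matrix.mul_assoc, hact, Matrix.smul_mul]
        congr 1
        rw [← Matrix.mul_assoc _ ((V x)⁻¹).val, Matrix.mul_assoc _ (V x).val, Units.mul_inv,
          Matrix.mul_one]
        simp only [Matrix.mul_assoc]
      simp only [W₁, Matrix.mul_sum, e, ← Finset.smul_sum]
      simp only [← Matrix.mul_sum, hS, Matrix.mul_one]
    have h₀₁ : W₀ * W₁ = (θ x : ℂ) • 1 := by
      have e : ∀ p p', L p p' * ((V x).val * aX p p') * W₁ = (θ x : ℂ) • (L p p' * X p p') := by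
        intro p p'
        rw [Matrix.mul_assoc, Matrix.mul_assoc, h₁, Matrix.mul_smul, Matrix.mul_smul,
          ← Matrix.mul_assoc (V x).val, Units.mul_inv, Matrix.one_mul]
      simp only [W₀, Matrix.sum_mul, e, ← Finset.smul_sum, hL]
    have hinv : W₀ * ((θ x : ℂ)⁻¹ • W₁) = 1 := by
      rw [Matrix.mul_smul, h₀₁, smul_smul, inv_mul_cancel₀ hθ, one_smul]
    have hinv' := mul_eq_one_comm.1 hinv
    refine ⟨⟨W₀, (θ x : ℂ)⁻¹ • W₁, hinv, hinv'⟩, fun p p' => ?_, fun q q' => ?_⟩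
    · change aX p p' = ((V x)⁻¹).val * X p p' * W₀
      rw [← Matrix.mul_one (aX p p'), ← hinv', ← Matrix.mul_assoc, Matrix.mul_smul, h₁, smul_smul,
        inv_mul_cancel₀ hθ, one_smul]
    · change aY q q' = (θ x : ℂ) • (((θ x : ℂ)⁻¹ • W₁) * Y q q' * (V x).val)
      rw [← Matrix.one_mul (aY q q'), ← hinv', Matrix.mul_assoc, h₀, Matrix.mul_smul,
        Matrix.mul_assoc]
  choose W hX hY using hW
  refine ⟨W, hX, hY, fun x y => ?_⟩
  have e : ∀ p p', X p p' * ((W x).val * twist x.right (W y).val) =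
      X p p' * ((ω (x, y) : ℂ) • (W (x * y)).val) := by
    intro p p'
    have h1 := hX (x * y) p p'
    have hXy : rectAction uP y X = fun p p' => ((V y)⁻¹).val * X p p' * (W y).val := by
      funext p p'; exact hX y p p'
    rw [← rectAction_rectAction huP, hXy, rectAction_mul_mul, hX] at h1
    have h2 := congrArg (fun M => ((V x).val * twist x.right (V y).val) * M) h1
    have c1 : twist x.right (V y).val * twist x.right ((V y)⁻¹).val = 1 := by
      rw [← twist_mul, Units.mul_inv, twist_one]
    have c2 : (V x).val * twist x.right (V y).val * (twist x.right ((V y)⁻¹).val *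
        (((V x)⁻¹).val * X p p' * (W x).val) * twist x.right (W y).val) =
        X p p' * ((W x).val * twist x.right (W y).val) := by
      calc _ = (V x).val * (twist x.right (V y).val * twist x.right ((V y)⁻¹).val) *
            ((V x)⁻¹).val * (X p p' * ((W x).val * twist x.right (W y).val)) := by
            simp only [Matrix.mul_assoc]
        _ = _ := by rw [c1, Matrix.mul_one, Units.mul_inv, Matrix.one_mul]
    rw [c2] at h2
    rw [h2, hmul, Matrix.smul_mul, Matrix.mul_smul, ← Matrix.mul_assoc, ← Matrix.mul_assoc,
      Units.mul_inv, Matrix.one_mul]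
  have e' : ∀ M : Matrix (Fin D) (Fin D) ℂ, ∑ p, ∑ p', L p p' * (X p p' * M) = M := by
    intro M
    simp only [← Matrix.mul_assoc, ← Matrix.sum_mul, hL, Matrix.one_mul]
  rw [← e' ((W x).val * _), ← e' ((ω (x, y) : ℂ) • (W (x * y)).val)]
  simp only [e]

/-- Every site of the old chain has parts in `P` and `Q`, and the new sites are composed of the `Q` part of
one old site and the `P` part of the next. A configuration of the new chain is sent to the configuration
of the old one; the old site `x` receives the `P` part of the new site `x` and the `Q` part of the new site
`x + 1`. -/
def regroup (e₁ : P × Q ≃ R) (e₂ : Q × P ≃ R) {n : ℕ} (σ : Fin n → R) : Fin n → R :=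
  fun x => e₁ ((e₂.symm (σ x)).2, (e₂.symm (σ (finRotate n x))).1)

/-- Shifting the boundaries of the sites preserves the class. If `B = X Y` is a minimal factorization
of the tensor, the new tensor is `Y X`; a block of two of these, `Y (X Y) X`, is injective because
`X Y` is. -/
theorem GeneratedInClass.regroup {u : G × K → Matrix R R ℂ} {uP : G × K → Matrix P P ℂ}
    {uQ : G × K → Matrix Q Q ℂ} (huP : ∀ g h, uP (g * h) = uP g * uP h) (e₁ : P × Q ≃ R)
    (e₂ : Q × P ≃ R) (h₁ : ∀ g p q p' q', u g (e₁ (p, q)) (e₁ (p', q')) = uP g p p' * uQ g q q')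
    (h₂ : ∀ g q p q' p', u g (e₂ (q, p)) (e₂ (q', p')) = uQ g q q' * uP g p p')
    {ρ : ChainState R} {c : SPTClass G K} (h : GeneratedInClass u ρ c) :
    GeneratedInClass (fun g => tensorPow 2 (u g))
      (MixedSPT.group 2 fun n => (ρ n).submatrix (MixedSPT.regroup e₁ e₂) (MixedSPT.regroup e₁ e₂))
      c := by
  obtain ⟨χ, B, hB, hρ, hc⟩ := h
  obtain ⟨D, X, Y, L, S, hXY, hL, hS⟩ := exists_minimal_factorization B e₁
  let B' : LocalTensor R D := fun i j =>
    Y (e₂.symm i).1 (e₂.symm j).1 * X (e₂.symm i).2 (e₂.symm j).2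
  have hB' : ∀ q p q' p', B' (e₂ (q, p)) (e₂ (q', p')) = Y q q' * X p p' := by
    intro q p q' p'
    simp [B']
  have hm : ∀ n, 0 < n → mpdo B' n =
      (mpdo B n).submatrix (MixedSPT.regroup e₁ e₂) (MixedSPT.regroup e₁ e₂) := by
    intro n hn
    ext σ τ
    simp only [mpdo_apply, blk, Matrix.submatrix_apply, MixedSPT.regroup, hXY]
    exact trace_prod_ofFn_rotate hn (fun i => Y (e₂.symm (σ i)).1 (e₂.symm (τ i)).1)
      (fun i => X (e₂.symm (σ i)).2 (e₂.symm (τ i)).2)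
  have hrep : Represents B' fun n =>
      (ρ n).submatrix (MixedSPT.regroup e₁ e₂) (MixedSPT.regroup e₁ e₂) := by
    intro n hn
    obtain ⟨s, hs, e⟩ := hρ n hn
    refine ⟨s, hs, ?_⟩
    simp only [hm n hn, e]
    rfl
  refine ⟨D, blk 2 B', ⟨fun n hn => ?_, ?_, ?_⟩, hrep.blk two_pos, ?_⟩
  · rw [← group_mpdo]
    refine posSemidef_group (fun n hn => ?_) two_pos n hn
    rw [hm n hn]
    exact (hB.posSemidef n hn).submatrix _
  · rw [injective_tensorMap_iff, spansMatrices_iff]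
    intro Z hZ
    have key : ∀ p p' q q', X p p' * (Z * Y q q') = 0 := by
      intro p p' q q'
      refine hB.spans.eq_zero fun r => ?_
      obtain ⟨⟨a, b⟩, ha⟩ := e₁.surjective r.1
      obtain ⟨⟨a', b'⟩, ha'⟩ := e₁.surjective r.2
      have := hZ (![e₂ (q, a), e₂ (b, p)], ![e₂ (q', a'), e₂ (b', p')])
      simp only [flatTensor, blk, List.ofFn_succ, List.ofFn_zero, Matrix.cons_val_zero,
        Matrix.cons_val_succ, hB', List.prod_cons,
        List.prod_nil, mul_one] at this
      rw [flatTensor, ← ha, ← ha', hXY]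
      rw [← this, Matrix.mul_assoc, Matrix.trace_mul_comm]
      simp only [Matrix.mul_assoc]
    have e1 : ∑ p, ∑ p', L p p' * (X p p' * Z) = Z := by
      simp only [← Matrix.mul_assoc, ← Matrix.sum_mul, hL, Matrix.one_mul]
    have e2 : ∑ q, ∑ q', Z * (Y q q' * S q q') = Z := by
      simp only [← Matrix.mul_sum, hS, Matrix.mul_one]
    have e3 : ∀ q q', Z * Y q q' = 0 := by
      intro q q'
      rw [← e1]
      simp only [Matrix.sum_mul, Matrix.mul_assoc, key, Matrix.mul_zero, Finset.sum_const_zero]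
    rw [← e2]
    simp only [← Matrix.mul_assoc, e3, Matrix.zero_mul, Finset.sum_const_zero]
  · obtain ⟨r, hr, hd⟩ := hB.exists_isDominant
    have t1 : transfer B = (∑ p, X p p) * ∑ q, Y q q := by
      simp only [transfer, ← e₁.sum_comp, Fintype.sum_prod_type, hXY, Matrix.sum_mul, Matrix.mul_sum]
      exact Finset.sum_comm
    have t2 : transfer B' = (∑ q, Y q q) * ∑ p, X p p := by
      simp only [transfer, ← e₂.sum_comp, Fintype.sum_prod_type, hB', Matrix.sum_mul, Matrix.mul_sum]
      exact Finset.sum_comm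
    rw [t1] at hd
    refine ⟨r ^ 2, ?_⟩
    rw [transfer_blk, t2]
    exact (hd.mul_comm hr).pow hr two_pos
  · refine HasTensorClass.blk ?_ 2
    rw [hasTensorClass_iff] at hc ⊢
    obtain ⟨V, θ, ω, hV, hω⟩ := hc
    obtain ⟨W, hWX, hWY, hW⟩ := exists_virtual_symmetry (uP := uP) (uQ := uQ) huP hL hS
      (fun x p q p' q' => by rw [← rectAction_split h₁ hXY, hV.act, hXY]) hV.mul
    refine ⟨W, θ, ω, ⟨fun x i j => ?_, hW⟩, hω⟩
    obtain ⟨⟨q, p⟩, rfl⟩ := e₂.surjective i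
    obtain ⟨⟨q', p'⟩, rfl⟩ := e₂.surjective j
    rw [rectAction_split h₂ hB', hWX, hWY, hB', Matrix.smul_mul]
    congr 1
    calc _ = ((W x)⁻¹).val * Y q q' * ((V x).val * ((V x)⁻¹).val) * (X p p' * (W x).val) := by
          simp only [Matrix.mul_assoc]
      _ = _ := by
          rw [Units.mul_inv, Matrix.mul_one]
          simp only [Matrix.mul_assoc]

end split

/-! ### Shifting a chain of two-site cells by one site -/

theorem finRotate_val {n : ℕ} (x : Fin n) : (finRotate n x : ℕ) = ((x : ℕ) + 1) % n := by
  cases n with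
  | zero => exact x.elim0
  | succ n =>
    rw [finRotate_apply, Fin.val_add]
    simp

theorem finRotate_finProdFinEquiv_of_lt {n m : ℕ} (x : Fin n) (y : Fin m) (h : (y : ℕ) + 1 < m) :
    finRotate (n * m) (finProdFinEquiv (x, y)) = finProdFinEquiv (x, ⟨y + 1, h⟩) := by
  ext
  rw [finRotate_val]
  simp only [finProdFinEquiv_apply_val]
  rw [Nat.mod_eq_of_lt]
  · ring
  · calc (y : ℕ) + m * x + 1 < m * (x + 1) := by rw [mul_add, mul_one]; omega
      _ ≤ m * n := Nat.mul_le_mul_left _ x.2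
      _ = n * m := mul_comm _ _

theorem finRotate_finProdFinEquiv_of_eq {n m : ℕ} (x : Fin n) (y : Fin m) (h : (y : ℕ) + 1 = m)
    (h0 : 0 < m) :
    finRotate (n * m) (finProdFinEquiv (x, y)) = finProdFinEquiv (finRotate n x, ⟨0, h0⟩) := by
  ext
  rw [finRotate_val]
  simp only [finProdFinEquiv_apply_val, finRotate_val]
  rw [show (y : ℕ) + m * x + 1 = m * (x + 1) by rw [mul_add, mul_one]; omega, mul_comm n m,
    Nat.mul_mod_mul_left, zero_add]

section shift

variable {α : Type*}

/-- Grouping the sites of a chain of cells into the pairs acted on by an odd layer. -/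
def pairEquiv (α : Type*) (n : ℕ) : (Fin n → Fin 2 → α) ≃ (Fin n → Fin 2 → α) where
  toFun σ x := pairOf true σ x
  invFun σ x := ![σ ((finRotate n).symm x) 1, σ x 0]
  left_inv σ := by
    funext x y
    fin_cases y
    · change σ (finRotate n ((finRotate n).symm x)) 0 = σ x 0
      rw [Equiv.apply_symm_apply]
    · rfl
  right_inv σ := by
    funext x y
    fin_cases y
    · rfl
    · change σ ((finRotate n).symm (finRotate n x)) 1 = σ x 1
      rw [Equiv.symm_apply_apply]

theorem pairEquiv_pairEquiv {n : ℕ} (σ : Fin n → Fin 2 → α) :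
    pairEquiv α n (pairEquiv α n σ) = fun x => σ (finRotate n x) := by
  funext x y
  fin_cases y <;> simp [pairEquiv, pairOf]

/-- The family of operators shifted by one site. -/
def shift (ρ : ChainState (Fin 2 → α)) : ChainState (Fin 2 → α) :=
  fun n => (ρ n).submatrix (pairEquiv α n) (pairEquiv α n)

/-- Invariance under translations by one site of the chain. -/
def IsTranslationInvariant {β : Type*} (ρ : ChainState β) : Prop :=
  ∀ n (σ τ : Fin n → β), ρ n (fun x => σ (finRotate n x)) (fun x => τ (finRotate n x)) = ρ n σ τ

theorem IsTranslationInvariant.shift {ρ : ChainState (Fin 2 → α)} (h : IsTranslationInvariant ρ) :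
    IsTranslationInvariant (shift ρ) :=
  fun n σ τ => h n (pairEquiv α n σ) (pairEquiv α n τ)

theorem IsTranslationInvariant.superLayer {β : Type*} [Fintype β] {ρ : ChainState β}
    (h : IsTranslationInvariant ρ) (S : Matrix (β × β) (β × β) ℂ) :
    IsTranslationInvariant (superLayer S ρ) := by
  intro n σ τ
  let e : (Fin n → β) ≃ (Fin n → β) := Equiv.arrowCongr (finRotate n).symm (Equiv.refl β)
  have he : ∀ σ, e σ = fun x => σ (finRotate n x) := fun σ => rfl
  simp only [MixedSPT.superLayer, superMap_apply]
  rw [← e.sum_comp]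
  refine Finset.sum_congr rfl fun σ' _ => ?_
  rw [← e.sum_comp]
  refine Finset.sum_congr rfl fun τ' _ => ?_
  rw [he, he, h]
  simp only [spow, Matrix.of_apply]
  congr 1
  exact Equiv.prod_comp (finRotate n) fun x => S (σ x, τ x) (σ' x, τ' x)

/-- For translation invariant families, an odd layer is an even layer between two shifts. -/
theorem applyLayer_true [Fintype α] [DecidableEq α] (N : Channel (Fin 2 → α))
    {ρ : ChainState (Fin 2 → α)} (h : IsTranslationInvariant ρ) :
    applyLayer true N ρ = shift (superLayer N.superop (shift ρ)) := by
  rw [← applyLayer_false]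
  funext n
  have hρ : ρ n = (shift ρ n).submatrix (pairEquiv α n) (pairEquiv α n) := by
    ext σ τ
    simp only [shift, Matrix.submatrix_apply, pairEquiv_pairEquiv, h n σ τ]
  have hs : ∀ a : Fin n → Fin N.num,
      (Matrix.of fun σ τ => ∏ x, N.kraus (a x) (pairOf true σ x) (pairOf true τ x)) =
      (Matrix.of fun σ τ : Fin n → Fin 2 → α =>
        ∏ x, N.kraus (a x) (pairOf false σ x) (pairOf false τ x)).submatrix
        (pairEquiv α n) (pairEquiv α n) := fun a => rfl
  have hsum : ∀ F : (Fin n → Fin N.num) → Matrix (Fin n → Fin 2 → α) (Fin n → Fin 2 → α) ℂ,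
      (∑ a, F a).submatrix (pairEquiv α n) (pairEquiv α n) =
        ∑ a, (F a).submatrix (pairEquiv α n) (pairEquiv α n) := fun F => by
    ext σ τ
    simp [Matrix.sum_apply]
  refine Eq.trans ?_ (hsum _).symm
  refine Finset.sum_congr rfl fun a _ => ?_
  simp only
  rw [hs, hρ, Matrix.conjTranspose_submatrix, Matrix.submatrix_mul_equiv,
    Matrix.submatrix_mul_equiv]

end shift

section unshift

variable {ι : Type*} {m M : ℕ}

/-- Enumeration of the `M + 1 = m * 2` sites of a block of `m` cells of two sites. -/
def sites (ι : Type*) (hM : m * 2 = M + 1) : (Fin m → Fin 2 → ι) ≃ (Fin (M + 1) → ι) :=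
  (concat ι m 2).trans (Equiv.arrowCongr (finCongr hM) (Equiv.refl ι))

theorem sites_apply (hM : m * 2 = M + 1) (a : Fin m → Fin 2 → ι) (y : Fin m) (z : Fin 2)
    (s : Fin (M + 1)) (hs : (s : ℕ) = z + 2 * y) : sites ι hM a s = a y z := by
  have : (finCongr hM).symm s = finProdFinEquiv (y, z) := by
    ext
    simpa using hs
  change concat ι m 2 a ((finCongr hM).symm s) = _
  rw [this, concat_apply]

theorem sites_symm_apply (hM : m * 2 = M + 1) (b : Fin (M + 1) → ι) (y : Fin m) (z : Fin 2)
    (s : Fin (M + 1)) (hs : (s : ℕ) = z + 2 * y) : (sites ι hM).symm b y z = b s := by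
  rw [← sites_apply hM ((sites ι hM).symm b) y z s hs, Equiv.apply_symm_apply]

theorem tensorPow_sites (hM : m * 2 = M + 1) (a : Matrix ι ι ℂ) (b b' : Fin (M + 1) → ι) :
    tensorPow m (tensorPow 2 a) ((sites ι hM).symm b) ((sites ι hM).symm b') =
      ∏ s, a (b s) (b' s) := by
  obtain ⟨σ, rfl⟩ := (sites ι hM).surjective b
  obtain ⟨σ', rfl⟩ := (sites ι hM).surjective b'
  rw [Equiv.symm_apply_apply, Equiv.symm_apply_apply, ← (finCongr hM).prod_comp, prod_concat]
  simp only [tensorPow, Matrix.of_apply]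
  refine Finset.prod_congr rfl fun y _ => Finset.prod_congr rfl fun z _ => ?_
  rw [sites_apply hM σ y z _ (by simp), sites_apply hM σ' y z _ (by simp)]

/-- Within blocks of `m` cells, the shift by one site moves the first site of every block into the
preceding block. -/
theorem pairEquiv_concat {n : ℕ} (hM : m * 2 = M + 1) (σ : Fin n → Fin m → Fin 2 → ι) :
    pairEquiv ι (n * m) (concat (Fin 2 → ι) n m σ) =
      concat (Fin 2 → ι) n m (regroup (P := Fin M → ι) (Q := ι)
        ((Equiv.prodComm _ _).trans ((Fin.snocEquiv fun _ => ι).trans (sites ι hM).symm))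
        ((Fin.consEquiv fun _ => ι).trans (sites ι hM).symm) σ) := by
  funext s z
  obtain ⟨⟨x, y⟩, rfl⟩ := finProdFinEquiv.surjective s
  have hm : 0 < m := y.pos
  have hy := y.2
  have hz := z.2
  rw [concat_apply]
  have hs : (z : ℕ) + 2 * y < M + 1 := by omega
  change _ = (sites ι hM).symm (Fin.snoc (α := fun _ => ι) (Fin.tail (sites ι hM (σ x)))
    (sites ι hM (σ (finRotate n x)) 0)) y z
  rw [sites_symm_apply hM _ y z ⟨_, hs⟩ rfl]
  have h00 : sites ι hM (σ (finRotate n x)) 0 = σ (finRotate n x) ⟨0, hm⟩ 0 :=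
    sites_apply hM _ _ _ _ (by simp)
  fin_cases z
  · have : (⟨0 + 2 * (y : ℕ), hs⟩ : Fin (M + 1)) = Fin.castSucc ⟨2 * y, by omega⟩ := by
      ext; simp
    change concat (Fin 2 → ι) n m σ (finProdFinEquiv (x, y)) 1 =
      Fin.snoc (α := fun _ => ι) _ _ ⟨0 + 2 * (y : ℕ), hs⟩
    rw [this, Fin.snoc_castSucc, concat_apply, Fin.tail]
    exact (sites_apply hM _ y 1 _ (by simp [add_comm])).symm
  · change concat (Fin 2 → ι) n m σ (finRotate _ (finProdFinEquiv (x, y))) 0 =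
      Fin.snoc (α := fun _ => ι) _ _ ⟨1 + 2 * (y : ℕ), hs⟩
    by_cases h : (y : ℕ) + 1 < m
    · have : (⟨1 + 2 * (y : ℕ), hs⟩ : Fin (M + 1)) = Fin.castSucc ⟨1 + 2 * y, by omega⟩ := by
        ext; simp
      rw [this, Fin.snoc_castSucc, finRotate_finProdFinEquiv_of_lt x y h, concat_apply, Fin.tail]
      exact (sites_apply hM _ _ 0 _ (by simp; ring)).symm
    · have : (⟨1 + 2 * (y : ℕ), hs⟩ : Fin (M + 1)) = Fin.last M := by
        ext; simp; omega
      rw [this, Fin.snoc_last, finRotate_finProdFinEquiv_of_eq x y (by omega) hm, concat_apply, h00]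

end unshift

section layers

variable {G K : Type} [Group G] [Group K] {ι : Type*} [Fintype ι]

/-- Shifting a family by one site, that is by half a cell, preserves its class. -/
theorem HasSPTClass.shift {u : G × K → Matrix ι ι ℂ} (hu : ∀ p q, u (p * q) = u p * u q)
    {ρ : ChainState (Fin 2 → ι)} {c : SPTClass G K}
    (h : HasSPTClass (fun p => tensorPow 2 (u p)) ρ c) :
    HasSPTClass (fun p => tensorPow 2 (u p)) (shift ρ) c := by
  obtain ⟨m, hm, h⟩ := hasSPTClass_iff.1 h
  obtain ⟨M, hM⟩ : ∃ M, m * 2 = M + 1 := ⟨m * 2 - 1, by omega⟩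
  refine hasSPTClass_iff.2 ⟨2 * m, by omega, ?_⟩
  refine GeneratedInClass.of_group_group ?_
  have := h.regroup (P := Fin M → ι) (Q := ι) (uP := fun p => tensorPow M (u p)) (uQ := u)
    (fun p q => by rw [hu, tensorPow_mul])
    ((Equiv.prodComm _ _).trans ((Fin.snocEquiv fun _ => ι).trans (sites ι hM).symm))
    ((Fin.consEquiv fun _ => ι).trans (sites ι hM).symm)
    (fun g p q p' q' => by
      simp only [Equiv.trans_apply, tensorPow_sites, Fin.prod_univ_castSucc]
      simp [Fin.snocEquiv, tensorPow])
    (fun g p q p' q' => by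
      simp only [Equiv.trans_apply, tensorPow_sites, Fin.prod_univ_succ]
      simp [Fin.consEquiv, tensorPow])
  convert this using 2
  funext n
  ext σ τ
  simp only [group_apply, MixedSPT.shift, Matrix.submatrix_apply]
  rw [pairEquiv_concat hM, pairEquiv_concat hM]

end layers

/-! ### Circuits -/

section circuit

variable {G K : Type} [Group G] [Group K] {ι : Type*} [Fintype ι] [DecidableEq ι]

theorem IsTranslationInvariant.applyLayer {ρ : ChainState (Fin 2 → ι)}
    (h : IsTranslationInvariant ρ) (b : Bool) (N : Channel (Fin 2 → ι)) :
    IsTranslationInvariant (applyLayer b N ρ) := by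
  cases b
  · rw [applyLayer_false]
    exact h.superLayer _
  · rw [applyLayer_true N h]
    exact (h.shift.superLayer _).shift

theorem HasSPTClass.applyLayer {u : G × K → Matrix ι ι ℂ} (hu : ∀ p q, u (p * q) = u p * u q)
    {ρ : ChainState (Fin 2 → ι)} (hρ : IsTranslationInvariant ρ) {c : SPTClass G K}
    (h : HasSPTClass (fun p => tensorPow 2 (u p)) ρ c) (b : Bool) {N : Channel (Fin 2 → ι)}
    (hN : IsSymmetricChannel (fun p => tensorPow 2 (u p)) N.superop) :
    HasSPTClass (fun p => tensorPow 2 (u p)) (applyLayer b N ρ) c := by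
  cases b
  · rw [applyLayer_false]
    exact h.superLayer hN
  · rw [applyLayer_true N hρ]
    exact ((h.shift hu).superLayer hN).shift hu

theorem HasSPTClass.apply {u : G × K → Matrix ι ι ℂ} (hu : ∀ p q, u (p * q) = u p * u q)
    (C : ChannelCircuit ι)
    (hC : ∀ l ∈ C, IsSymmetricChannel (fun p => tensorPow 2 (u p)) l.2.superop)
    {ρ : ChainState (Fin 2 → ι)} (hρ : IsTranslationInvariant ρ) {c : SPTClass G K}
    (h : HasSPTClass (fun p => tensorPow 2 (u p)) ρ c) :
    HasSPTClass (fun p => tensorPow 2 (u p)) (C.apply ρ) c := by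
  induction C generalizing ρ with
  | nil => exact h
  | cons l C ih =>
    exact ih (fun l' hl' => hC l' (List.mem_cons_of_mem _ hl')) (hρ.applyLayer l.1 l.2)
      (h.applyLayer hu hρ l.1 (hC l List.mem_cons_self))

theorem isTranslationInvariant_group_mpdo {α : Type*} {χ : ℕ} (A : LocalTensor α χ) (m : ℕ) :
    IsTranslationInvariant (group m (mpdo A)) := by
  rw [group_mpdo]
  exact mpdo_rotate _

/-- The operator on `n` sites is invariant, up to a factor, under conjugation with the tensor power
of `a`. -/
def IsConjInvariant {β : Type*} [Fintype β] (a : Matrix β β ℂ) (ρ : ChainState β) (n : ℕ) : Prop :=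
  ∃ θ : ℂ, tensorPow n a * ρ n * (tensorPow n a)ᴴ = θ • ρ n

theorem IsConjInvariant.of_shift {ι : Type*} [Fintype ι] {a : Matrix ι ι ℂ} {ρ : ChainState (Fin 2 → ι)} {n : ℕ}
    (h : IsConjInvariant (tensorPow 2 a) (shift ρ) n) : IsConjInvariant (tensorPow 2 a) ρ n := by
  obtain ⟨θ, e⟩ := h
  refine ⟨θ, ?_⟩
  have ht : tensorPow n (tensorPow 2 a) =
      (tensorPow n (tensorPow 2 a)).submatrix (pairEquiv ι n) (pairEquiv ι n) := by
    ext σ τ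
    simp only [tensorPow, Matrix.submatrix_apply, Matrix.of_apply, Fin.prod_univ_two,
      Finset.prod_mul_distrib]
    rw [mul_comm, ← Equiv.prod_comp (finRotate n) fun x => a (σ x 0) (τ x 0)]
    rfl
  have hρ : shift ρ n = (ρ n).submatrix (pairEquiv ι n) (pairEquiv ι n) := rfl
  rw [ht, hρ, Matrix.conjTranspose_submatrix, Matrix.submatrix_mul_equiv,
    Matrix.submatrix_mul_equiv] at e
  ext σ τ
  have := congrFun (congrFun e ((pairEquiv ι n).symm σ)) ((pairEquiv ι n).symm τ)
  simpa only [Matrix.submatrix_apply, Matrix.smul_apply, Equiv.apply_symm_apply] using this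

/-- A symmetry of the output of a layer of symmetric non-degenerate channels is a symmetry of the
input, because the layer is injective and commutes with the symmetry. -/
theorem IsConjInvariant.of_superLayer {β : Type*} [Fintype β] [DecidableEq β]
    {v : G × K → Matrix β β ℂ} {S : Matrix (β × β) (β × β) ℂ} (hS : IsSymmetricChannel v S)
    (p : G × K) {ρ : ChainState β} {n : ℕ} (h : IsConjInvariant (v p) (superLayer S ρ) n) :
    IsConjInvariant (v p) ρ n := by
  obtain ⟨θ, e⟩ := h
  obtain ⟨z, -, hz⟩ := (hS.spow n).comm (SemidirectProduct.inl (p.1, p.1, p.2))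
  have hsym : symSuper (fun p => tensorPow n (v p))
      (SemidirectProduct.inl (p.1, p.1, p.2) : DoubledSymmetry G K) =
      sandwich (tensorPow n (v p)) (tensorPow n (v p)) := rfl
  rw [hsym] at hz
  obtain ⟨T, hT⟩ := (isUnit_spow hS.isUnit n).exists_left_inv
  rw [superLayer, ← superMap_sandwich, ← superMap_mul] at e
  refine ⟨z * θ, ?_⟩
  have h1 : superMap (spow n S * sandwich (tensorPow n (v p)) (tensorPow n (v p))) (ρ n) =
      superMap (spow n S) ((z * θ) • ρ n) := by
    rw [hz, smul_superMap, e, superMap_smul, smul_smul]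
  have h2 := congrArg (superMap T) h1
  rw [← superMap_mul, ← mul_assoc, hT, one_mul, ← superMap_mul, hT, superMap_sandwich] at h2
  rw [h2]
  exact congrArg Matrix.of (lin_one _)

theorem IsConjInvariant.of_apply {u : G × K → Matrix ι ι ℂ} (C : ChannelCircuit ι)
    (hC : ∀ l ∈ C, IsSymmetricChannel (fun p => tensorPow 2 (u p)) l.2.superop)
    {ρ : ChainState (Fin 2 → ι)} (hρ : IsTranslationInvariant ρ) (p : G × K) {n : ℕ}
    (h : IsConjInvariant (tensorPow 2 (u p)) (C.apply ρ) n) :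
    IsConjInvariant (tensorPow 2 (u p)) ρ n := by
  induction C generalizing ρ with
  | nil => exact h
  | cons l C ih =>
    obtain ⟨b, N⟩ := l
    have hN := hC (b, N) List.mem_cons_self
    have h1 := ih (fun l' hl' => hC l' (List.mem_cons_of_mem _ hl')) (hρ.applyLayer b N) h
    cases b
    · rw [applyLayer_false] at h1
      exact h1.of_superLayer hN p
    · rw [applyLayer_true N hρ] at h1
      exact (h1.of_shift.of_superLayer hN p).of_shift

/-- A family in an SPT phase is symmetric on some ring. -/
theorem HasSPTClass.exists_isConjInvariant {β : Type*} [Fintype β] {v : G × K → Matrix β β ℂ}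
    {ρ : ChainState β} {c : SPTClass G K} (h : HasSPTClass v ρ c) :
    ∃ n, 0 < n ∧ ∀ p, IsConjInvariant (v p) ρ n := by
  obtain ⟨m, hm, χ, B, hB, hρ, hc⟩ := h
  rw [hasTensorClass_iff] at hc
  obtain ⟨V, θ, ω, hV, -⟩ := hc
  refine ⟨1 * m, by omega, fun p => ?_⟩
  obtain ⟨s, hs, e⟩ := hρ 1 one_pos
  let x : DoubledSymmetry G K := SemidirectProduct.inl (p.1, p.1, p.2)
  have h1 := mpdo_rectAction (fun p => tensorPow m (v p)) x B 1 (hB.posSemidef 1 one_pos).isHermitian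
  have h2 : mpdo (rectAction (fun p => tensorPow m (v p)) x B) 1 = (θ x : ℂ) • mpdo B 1 := by
    have : rectAction (fun p => tensorPow m (v p)) x B =
        fun i j => (θ x : ℂ) • (((V x)⁻¹).val * B i j * (V x).val) := by
      funext i j; exact hV.act x i j
    ext σ τ
    rw [this, mpdo_apply, blk_conj, Matrix.trace_smul, Matrix.trace_mul_comm, ← mul_assoc,
      Units.mul_inv, one_mul, pow_one]
    rfl
  refine ⟨θ x, ?_⟩
  have h3 : tensorPow 1 (tensorPow m (v p)) * group m ρ 1 * (tensorPow 1 (tensorPow m (v p)))ᴴ =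
      (θ x : ℂ) • group m ρ 1 := by
    rw [e, Matrix.mul_smul, Matrix.smul_mul, smul_comm (θ x : ℂ), ← h2, h1]
    rfl
  have ht : tensorPow 1 (tensorPow m (v p)) =
      (tensorPow (1 * m) (v p)).submatrix (concat β 1 m) (concat β 1 m) := by
    ext σ τ
    simp only [tensorPow, Matrix.submatrix_apply, Matrix.of_apply, prod_concat, concat_apply]
  rw [ht, group_apply, Matrix.conjTranspose_submatrix, Matrix.submatrix_mul_equiv,
    Matrix.submatrix_mul_equiv] at h3
  ext σ τ
  have := congrFun (congrFun h3 ((concat β 1 m).symm σ)) ((concat β 1 m).symm τ)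
  simpa only [Matrix.submatrix_apply, Matrix.smul_apply, Equiv.apply_symm_apply] using this

theorem HasSPTClass.congr {β : Type*} [Fintype β] {v : G × K → Matrix β β ℂ}
    {ρ ρ' : ChainState β} {c : SPTClass G K} (h : HasSPTClass v ρ c)
    (hρ : ∀ n, 0 < n → ρ n = ρ' n) : HasSPTClass v ρ' c := by
  obtain ⟨m, hm, χ, B, hB, hr, hc⟩ := h
  refine ⟨m, hm, χ, B, hB, fun n hn => ?_, hc⟩
  rw [group_apply, ← hρ _ (Nat.mul_pos hn hm)]
  exact hr n hn

end circuit

/-! ### Product states -/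

section product

variable {G K : Type} [Group G] [Group K] {ι : Type*}

/-- The tensor of bond dimension one generating a product state. -/
def productTensor (φ : ι → ℂ) : LocalTensor ι 1 := fun i j => (φ i * conj (φ j)) • 1

theorem mpdo_productTensor (φ : ι → ℂ) : mpdo (productTensor φ) = productState φ := by
  funext n
  ext σ τ
  rw [mpdo_apply, blk]
  simp only [productTensor, list_prod_ofFn_smul]
  simp [productState, Finset.prod_mul_distrib]

theorem isStrongInjective_productTensor [Fintype ι] {φ : ι → ℂ} (hφ : ∑ i, ‖φ i‖ ^ 2 = 1) :
    IsStrongInjective (productTensor φ) where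
  posSemidef n _ := by
    rw [mpdo_productTensor]
    exact Matrix.posSemidef_vecMulVec_self_star fun σ : Fin n → ι => ∏ x, φ (σ x)
  injective := by
    rw [injective_tensorMap_iff, spansMatrices_iff]
    intro Z hZ
    obtain ⟨i, hi⟩ : ∃ i, φ i ≠ 0 := by
      by_contra! h
      simp [h] at hφ
    have := hZ (i, i)
    simp only [flatTensor, productTensor, Matrix.mul_smul, mul_one, Matrix.trace_smul, smul_eq_mul,
      mul_eq_zero, hi, map_eq_zero, false_or] at this
    ext a b
    rw [Subsingleton.elim a 0, Subsingleton.elim b 0]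
    simpa [Matrix.trace] using this
  transfer_gap := by
    have ht : transfer (productTensor φ) = 1 := by
      have : ∑ i, φ i * conj (φ i) = 1 := by
        simp only [Complex.mul_conj']
        exact_mod_cast hφ
      simp only [transfer, productTensor, ← Finset.sum_smul, this, one_smul]
    refine ⟨1, ?_⟩
    rw [ht, Matrix.charpoly_one, Fintype.card_fin, pow_one]
    constructor
    · simpa using Polynomial.rootMultiplicity_X_sub_C_self (x := (1 : ℂ))
    · intro z hz hz1
      refine absurd ?_ hz1
      simpa [sub_eq_zero] using hz

/-- A tensor of bond dimension one has trivial class: its virtual symmetry is trivial. -/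
theorem hasTensorClass_productTensor [Fintype ι] {u : G × K → Matrix ι ι ℂ} {φ : ι → ℂ}
    {l : G × K → Circle} (hl : ∀ p, u p *ᵥ φ = (l p : ℂ) • φ) :
    HasTensorClass u (productTensor φ) (0 : SPTClass G K) := by
  have hmul : ∀ x y : DoubledSymmetry G K, (1 : GL (Fin 1) ℂ).val *
      twist x.right (1 : GL (Fin 1) ℂ).val =
      (((fun _ => 1 : DoubledSymmetry G K × DoubledSymmetry G K → Circle) (x, y) : Circle) : ℂ) •
        (1 : GL (Fin 1) ℂ).val := by
    intro x y
    simp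
  rw [hasTensorClass_iff]
  refine ⟨fun _ => 1, fun x => l (x.left.1, x.left.2.2) * (l (x.left.2.1, x.left.2.2))⁻¹,
    fun _ => 1, ⟨fun x i j => ?_, hmul⟩, isMulCocycle₂_of_mul one_pos hmul, ?_⟩
  · have ht : twistLegs x.right (productTensor φ) = productTensor φ := by
      funext i j
      rcases zmodTwo_cases x.right with h | h
      · simp [twistLegs, h]
      · rw [h]
        have h1 : (Multiplicative.ofAdd (1 : ZMod 2)) ≠ 1 := by decide
        simp only [twistLegs, if_neg h1, productTensor, twist_smul, twistScalar_nontrivial,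
          twist_one, map_mul, Complex.conj_conj, mul_comm]
    have hp : ∀ p i, ∑ i', u p i i' * φ i' = l p * φ i := fun p i => congrFun (hl p) i
    have hp' : ∀ p i, ∑ i', conj (u p i i') * conj (φ i') = conj (l p : ℂ) * conj (φ i) := by
      intro p i
      rw [← map_mul, ← hp, map_sum]
      simp only [map_mul]
    rw [rectAction, ht]
    simp only [lin, symSuper, sandwich, Matrix.of_apply, productTensor, smul_smul,
      ← Finset.sum_smul, inv_one, Units.val_one, one_mul, mul_one, Circle.coe_mul,
      Circle.coe_inv_eq_conj]
    congr 1
    rw [show ∀ a b c d : ℂ, a * b * (c * d) = (a * c) * (b * d) from fun a b c d => by ring,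
      ← hp, ← hp', Finset.sum_mul_sum]
    exact Finset.sum_congr rfl fun _ _ => Finset.sum_congr rfl fun _ _ => by ring
  · have : groupCohomology.cocyclesOfIsMulCocycle₂ (isMulCocycle₂_of_mul one_pos hmul) = 0 := rfl
    rw [this, map_zero]

theorem group_productState (m : ℕ) (φ : ι → ℂ) :
    group m (productState φ) = productState fun c : Fin m → ι => ∏ y, φ (c y) := by
  funext n
  ext σ τ
  simp only [group_apply, productState, Matrix.submatrix_apply, Matrix.of_apply, prod_concat,
    concat_apply]

theorem tensorPow_mulVec [Fintype ι] (n : ℕ) (a : Matrix ι ι ℂ) (φ : ι → ℂ) :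
    (tensorPow n a *ᵥ fun σ => ∏ x, φ (σ x)) = fun σ => ∏ x, (a *ᵥ φ) (σ x) := by
  funext σ
  simp only [Matrix.mulVec, dotProduct, tensorPow, Matrix.of_apply, ← Finset.prod_mul_distrib]
  rw [Finset.prod_univ_sum, Fintype.piFinset_univ]

theorem tensorPow_mul_productState_mul [Fintype ι] (n : ℕ) (a : Matrix ι ι ℂ) (φ : ι → ℂ) :
    tensorPow n a * productState φ n * (tensorPow n a)ᴴ = productState (a *ᵥ φ) n := by
  have h : ∀ φ : ι → ℂ, productState φ n =
      Matrix.vecMulVec (fun σ : Fin n → ι => ∏ x, φ (σ x)) (star fun σ => ∏ x, φ (σ x)) :=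
    fun φ => rfl
  rw [h, h, Matrix.mul_vecMulVec, Matrix.vecMulVec_mul, ← Matrix.star_mulVec, tensorPow_mulVec]

/-- Vectors with proportional product states are proportional. -/
theorem exists_smul_of_productState {φ ψ : ι → ℂ} {n : ℕ} (hn : 0 < n) (hψ : ψ ≠ 0) {θ : ℂ}
    (h : productState ψ n = θ • productState φ n) : ∃ l : ℂ, ψ = l • φ := by
  obtain ⟨j, hj⟩ := Function.ne_iff.1 hψ
  obtain ⟨k, rfl⟩ : ∃ k, n = k + 1 := ⟨n - 1, by omega⟩
  set A : ℂ := ψ j ^ k * conj (ψ j ^ (k + 1)) with hA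
  have hA0 : A ≠ 0 := mul_ne_zero (pow_ne_zero _ hj)
    ((map_ne_zero _).2 (pow_ne_zero _ hj))
  refine ⟨A⁻¹ * (θ * (φ j ^ k * conj (φ j ^ (k + 1)))), funext fun i => ?_⟩
  have := congrFun (congrFun h (Fin.cons i fun _ => j)) fun _ => j
  simp only [productState, Matrix.of_apply, Matrix.smul_apply, Fin.prod_univ_succ, Fin.cons_zero,
    Fin.cons_succ, Finset.prod_const, Finset.card_univ, Fintype.card_fin, smul_eq_mul] at this
  rw [Pi.smul_apply, smul_eq_mul, mul_assoc, eq_inv_mul_iff_mul_eq₀ hA0, hA, pow_succ', pow_succ']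
  linear_combination this

theorem sum_norm_sq_mulVec [Fintype ι] [DecidableEq ι] {a : Matrix ι ι ℂ} (ha : aᴴ * a = 1)
    (φ : ι → ℂ) : ∑ i, ‖(a *ᵥ φ) i‖ ^ 2 = ∑ i, ‖φ i‖ ^ 2 := by
  have h : ∀ f : ι → ℂ, ((∑ i, ‖f i‖ ^ 2 : ℝ) : ℂ) = star f ⬝ᵥ f := by
    intro f
    simp [dotProduct, Complex.conj_mul']
  have : star (a *ᵥ φ) ⬝ᵥ (a *ᵥ φ) = star φ ⬝ᵥ φ := by
    rw [Matrix.star_mulVec, ← Matrix.dotProduct_mulVec, Matrix.mulVec_mulVec, ha, Matrix.one_mulVec]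
  rw [← h, ← h] at this
  exact_mod_cast this

/-- If a product state is invariant up to a factor under the tensor power of a unitary matrix, the
on-site vector is an eigenvector of that matrix. -/
theorem exists_eigenvalue_of_isConjInvariant [Fintype ι] [DecidableEq ι] {a : Matrix ι ι ℂ}
    (ha : aᴴ * a = 1) {φ : ι → ℂ} (hφ : ∑ i, ‖φ i‖ ^ 2 = 1) {n : ℕ} (hn : 0 < n)
    (h : IsConjInvariant (tensorPow 2 a) (group 2 (productState φ)) n) :
    ∃ l : Circle, a *ᵥ φ = (l : ℂ) • φ := by
  obtain ⟨θ, e⟩ := h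
  rw [group_productState, tensorPow_mul_productState_mul, tensorPow_mulVec] at e
  have hnorm := sum_norm_sq_mulVec ha φ
  rw [hφ] at hnorm
  obtain ⟨j, hj⟩ : ∃ j, (a *ᵥ φ) j ≠ 0 := by
    by_contra! h
    simp [h] at hnorm
  obtain ⟨l, hl⟩ := exists_smul_of_productState hn
    (Function.ne_iff.2 ⟨fun _ => j, by simpa using hj⟩) e
  have hk : a *ᵥ φ = (((a *ᵥ φ) j)⁻¹ * (l * φ j)) • φ := by
    funext i
    have := congrFun hl ![i, j]
    simp only [Fin.prod_univ_two, Pi.smul_apply, smul_eq_mul, Matrix.cons_val_zero,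
      Matrix.cons_val_one] at this
    rw [Pi.smul_apply, smul_eq_mul, mul_assoc, eq_inv_mul_iff_mul_eq₀ hj]
    linear_combination this
  set k := ((a *ᵥ φ) j)⁻¹ * (l * φ j)
  have hk1 : ‖k‖ = 1 := by
    rw [hk] at hnorm
    simp only [Pi.smul_apply, smul_eq_mul, norm_mul, mul_pow, ← Finset.mul_sum, hφ, mul_one] at hnorm
    exact (pow_eq_one_iff_of_nonneg (norm_nonneg k) two_ne_zero).1 hnorm
  exact ⟨⟨k, mem_sphere_zero_iff_norm.2 hk1⟩, hk⟩

end product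

end MixedSPT
end

theorem mainTheorem3 {G K : Type} [Group G] [Group K] {ι : Type*} [Fintype ι] [DecidableEq ι]
    (U : G × K →* Matrix.unitaryGroup ι ℂ)
    (C : MixedSPT.ChannelCircuit ι)
    (hnondeg : ∀ l ∈ C, l.2.IsNondegenerate)
    (hsymm : ∀ l ∈ C, l.2.IsSymmetric fun p => MixedSPT.tensorPow 2 (U p : Matrix ι ι ℂ)) :
    (∀ (χ : ℕ) (A : MixedSPT.LocalTensor ι χ),
      MixedSPT.IsStrongInjective A →
      MixedSPT.IsSymmetricState (fun p => (U p : Matrix ι ι ℂ)) (MixedSPT.mpdo A) →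
      MixedSPT.SameSPTPhase (fun p => (U p : Matrix ι ι ℂ)) (MixedSPT.mpdo A)
        (fun p => MixedSPT.tensorPow 2 (U p : Matrix ι ι ℂ))
        (C.apply (MixedSPT.group 2 (MixedSPT.mpdo A)))) ∧
    (∀ (ρ : MixedSPT.ChainState (Fin 2 → ι)) (c : MixedSPT.SPTClass G K),
      MixedSPT.HasSPTClass (fun p => MixedSPT.tensorPow 2 (U p : Matrix ι ι ℂ)) ρ c →
      c ≠ 0 →
      ¬ ∃ φ : ι → ℂ, (∑ i, ‖φ i‖ ^ 2 = 1) ∧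
        ∀ n, 0 < n → C.apply (MixedSPT.group 2 (MixedSPT.productState φ)) n = ρ n) := by
  have hu : ∀ p q, (U (p * q) : Matrix ι ι ℂ) = U p * U q := fun p q => by
    rw [map_mul]; rfl
  have hu1 : (U 1 : Matrix ι ι ℂ) = 1 := by rw [map_one]; rfl
  have huu : ∀ p, (U p : Matrix ι ι ℂ)ᴴ * U p = 1 := fun p =>
    Matrix.mem_unitaryGroup_iff'.1 (U p).2
  have hC : ∀ l ∈ C, MixedSPT.IsSymmetricChannel
      (fun p => MixedSPT.tensorPow 2 (U p : Matrix ι ι ℂ)) l.2.superop := fun l hl =>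
    (hsymm l hl).isSymmetricChannel (fun p q => by rw [hu, MixedSPT.tensorPow_mul])
      (fun p => by
        rw [← MixedSPT.tensorPow_conjTranspose, ← MixedSPT.tensorPow_mul, huu,
          MixedSPT.tensorPow_one])
      (hnondeg l hl)
  -- a generating tensor of `ρ` yields classes of `ρ` and of the output of the circuit
  have key : ∀ (χ : ℕ) (A : MixedSPT.LocalTensor ι χ) (c : MixedSPT.SPTClass G K),
      MixedSPT.GeneratedInClass (fun p => (U p : Matrix ι ι ℂ)) (MixedSPT.mpdo A) c →
      MixedSPT.HasSPTClass (fun p => (U p : Matrix ι ι ℂ)) (MixedSPT.mpdo A) c ∧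
      MixedSPT.HasSPTClass (fun p => MixedSPT.tensorPow 2 (U p : Matrix ι ι ℂ))
        (C.apply (MixedSPT.group 2 (MixedSPT.mpdo A))) c := by
    intro χ A c h
    refine ⟨MixedSPT.hasSPTClass_iff.2 ⟨1, one_pos, h.group one_pos⟩,
      MixedSPT.HasSPTClass.apply hu C hC (MixedSPT.isTranslationInvariant_group_mpdo A 2)
        (MixedSPT.hasSPTClass_iff.2 ⟨1, one_pos, (h.group two_pos).group one_pos⟩)⟩
  refine ⟨fun χ A hA hsym => ?_, fun ρ c hc hc0 => ?_⟩
  · obtain ⟨c, h⟩ := hA.exists_generatedInClass hu hu1 hsym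
    obtain ⟨h1, h2⟩ := key χ A c h
    exact ⟨c, fun c' => ⟨fun h' => h'.unique h1, fun e => e ▸ h1⟩,
      fun c' => ⟨fun h' => h'.unique h2, fun e => e ▸ h2⟩⟩
  · rintro ⟨φ, hφ, hρ⟩
    have hc' := hc.congr fun n hn => (hρ n hn).symm
    obtain ⟨n, hn, hinv⟩ := hc'.exists_isConjInvariant
    have hTI : MixedSPT.IsTranslationInvariant (MixedSPT.group 2 (MixedSPT.productState φ)) := by
      rw [← MixedSPT.mpdo_productTensor]
      exact MixedSPT.isTranslationInvariant_group_mpdo _ 2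
    choose l hl using fun p => MixedSPT.exists_eigenvalue_of_isConjInvariant (huu p) hφ hn
      (MixedSPT.IsConjInvariant.of_apply (u := fun p => (U p : Matrix ι ι ℂ)) C hC hTI p (hinv p))
    have h0 : MixedSPT.GeneratedInClass (fun p => (U p : Matrix ι ι ℂ))
        (MixedSPT.mpdo (MixedSPT.productTensor φ)) (0 : MixedSPT.SPTClass G K) :=
      ⟨1, _, MixedSPT.isStrongInjective_productTensor hφ, fun n _ => ⟨1, one_pos, by simp⟩,
        MixedSPT.hasTensorClass_productTensor hl⟩
    have h2 := (key 1 _ 0 h0).2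
    rw [MixedSPT.mpdo_productTensor] at h2
    exact hc0 (hc'.unique h2)
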